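/- All simplicial complexes are finite. The $2$-chromatic number $\chi_2(K)$ of a simplicial complex $K$ is the least number of colors in a coloring of its vertices for which no $3$-element face is monochromatic. A triangulated closed surface is a connected pure $2$-dimensional simplicial complex in which every vertex link is a cycle; it is orientable if its triangles can be oriented coherently. A Steiner triple system $\mathrm{STS}(n)$ is a pure $2$-dimensional simplicial complex on $n$ vertices whose $1$-skeleton is the complete graph $K_n$ and in which every edge lies in a unique triangle. Theorem ($\chi_2(\text{arbitrary surface})=\infty$). (i) For every $k$ there are an orientable triangulated closed surface $K$ and a non-orientable triangulated closed surface $K'$ with $\chi_2(K)\ge k$ and $\chi_2(K')\ge k$. (ii) For every $k$ there is a Steiner triple system $\mathrm{STS}(n)$ with $n>3$ and $\chi_2(\mathrm{STS}(n))\ge k$. (iii) Let $n>3$, let $T$ be any Steiner triple system $\mathrm{STS}(n)$, and put $m=\binom n2$. Then there are an orientable and a non-orientable triangulated closed surface $K$ that contain $T$ as a subcomplex and are of the following form. There is a closed walk $w_0,w_1,\dots,w_{m-1},w_0$ in $K_n$ traversing each edge exactly once (the boundary of a single polygonal cell complementary to $T$); $K$ has, besides the $n$ vertices of $T$, exactly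 $m$ further vertices $u_0,\dots,u_{m-1}$; and, with indices modulo $m$, the triangles of $K$ are exactly the triangles of $T$, the $2m$ triangles $\{w_i,w_{i+1},u_i\}$ and $\{w_{i+1},u_i,u_{i+1}\}$ of a zigzag annulus, and the $m-2$ triangles of a triangulation of the inner polygon $u_0u_1\cdots u_{m-1}$ by non-crossing chords. Moreover, $K$ has face vector $$f=(f_0,f_1,f_2)=\Bigl(n+\tbinom n2,\ 5\tbinom n2-3,\ \tfrac13\tbinom n2+3\tbinom n2-2\Bigr),$$ Euler characteristic $\chi_E(K)=2-\tfrac13(n-1)(n-3)$, and $\chi_2(K)\ge\chi_2(T)$. -/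

import Mathlib

namespace AbstractSimplicialComplex

section General

variable {V : Type*}

/-- A colouring of the vertices is `s`-admissible if no face with `s + 1` vertices is
monochromatic. -/
def IsColoring (K : AbstractSimplicialComplex V) (s : ℕ) {C : Type*} (c : V → C) : Prop :=
  ∀ t ∈ K, t.card = s + 1 → ¬ ∃ a : C, ∀ v ∈ t, c v = a

/-- The `s`-chromatic number: the least number of colours in an `s`-admissible vertex colouring
(with value `⊤` if no finite number of colours suffices). -/
noncomputable def chromaticNumber (K : AbstractSimplicialComplex V) (s : ℕ) : ℕ∞ :=
  ⨅ k ∈ {k : ℕ | ∃ c : V → Fin k, K.IsColoring s c}, (k : ℕ∞)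

/-- `f_i`, the number of `i`-dimensional faces. -/
noncomputable def faceNumber (K : AbstractSimplicialComplex V) (i : ℕ) : ℕ :=
  {t : Finset V | t ∈ K ∧ t.card = i + 1}.ncard

/-- The Euler characteristic `∑ (-1)^i f_i` of a complex on a finite vertex set. -/
noncomputable def eulerChar (K : AbstractSimplicialComplex V) : ℤ :=
  ∑ i ∈ Finset.range (Nat.card V), (-1) ^ i * (K.faceNumber i : ℤ)

/-- Every face lies in a `d`-dimensional face, and no face has larger dimension. -/
def IsPure (K : AbstractSimplicialComplex V) (d : ℕ) : Prop :=
  ∀ t ∈ K, t.card ≤ d + 1 ∧ ∃ u ∈ K, t ⊆ u ∧ u.card = d + 1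

variable [DecidableEq V]

/-- `a`, `b`, `c` are the three distinct vertices of a 2-face. -/
def IsTriangle (K : AbstractSimplicialComplex V) (a b c : V) : Prop :=
  a ≠ b ∧ a ≠ c ∧ b ≠ c ∧ ({a, b, c} : Finset V) ∈ K

/-- The graph of vertices and edges of the complex. -/
def oneSkeleton (K : AbstractSimplicialComplex V) : SimpleGraph V where
  Adj a b := a ≠ b ∧ ({a, b} : Finset V) ∈ K
  symm := ⟨fun a b h => ⟨h.1.symm, by rw [Finset.pair_comm]; exact h.2⟩⟩
  loopless := ⟨fun _ h => h.1 rfl⟩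

/-- The link of the vertex `v` in a 2-dimensional complex, as a graph; its vertices are the
neighbours of `v`, its edges the edges opposite to `v` in the triangles at `v`. -/
def linkGraph (K : AbstractSimplicialComplex V) (v : V) :
    SimpleGraph (K.oneSkeleton.neighborSet v) where
  Adj a b := K.IsTriangle v a b
  symm := ⟨fun a b h => ⟨h.2.1, h.1, h.2.2.1.symm, by rw [Finset.pair_comm]; exact h.2.2.2⟩⟩
  loopless := ⟨fun _ h => h.2.2.1 rfl⟩

/-- A triangulated closed surface: a finite connected pure 2-dimensional complex in which every
vertex link is a cycle, i.e. a finite connected graph all of whose vertices have degree 2. -/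
structure IsClosedSurface (K : AbstractSimplicialComplex V) : Prop where
  finite : Finite V
  pure : K.IsPure 2
  connected : K.oneSkeleton.Connected
  link_connected : ∀ v, (K.linkGraph v).Connected
  link_degree : ∀ v a, ((K.linkGraph v).neighborSet a).ncard = 2

/-- Orientability of a triangulated surface: `P a b c` says that `(a, b, c)` is a positive ordering
of its triangle. It depends only on the cyclic order, is reversed by transpositions, and two
triangles with a common edge induce opposite directions on that edge. -/
def IsOrientable (K : AbstractSimplicialComplex V) : Prop :=
  ∃ P : V → V → V → Prop,
    (∀ a b c, K.IsTriangle a b c → (P a b c ↔ P b c a)) ∧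
    (∀ a b c, K.IsTriangle a b c → (P a b c ↔ ¬ P b a c)) ∧
    (∀ a b c d, K.IsTriangle a b c → K.IsTriangle a b d → c ≠ d → (P a b c ↔ P b a d))

/-- A Steiner triple system: a pure 2-dimensional complex with complete 1-skeleton in which every
edge lies in a unique triangle. -/
structure IsSteinerTripleSystem (T : AbstractSimplicialComplex V) : Prop where
  pure : T.IsPure 2
  complete : ∀ x y : V, ({x, y} : Finset V) ∈ T
  unique : ∀ e ∈ T, e.card = 2 → ∃! t : Finset V, t ∈ T ∧ t.card = 3 ∧ e ⊆ t

end General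

/-- The closed walk `w 0, w 1, …, w (m - 1), w 0` is an Eulerian circuit of the complete graph:
it traverses every edge exactly once. (`finRotate m` is the cyclic successor on `Fin m`.) -/
def IsEulerianCircuit {V : Type*} {m : ℕ} (w : Fin m → V) : Prop :=
  Set.BijOn (fun i => s(w i, w (finRotate m i))) Set.univ {e : Sym2 V | ¬ e.IsDiag}

/-- A triangulation of the convex `m`-gon with vertices `0, …, m - 1` in cyclic order by chords:
`m - 2` triangles on the vertices of the polygon, no two of which have crossing sides. -/
structure IsPolygonTriangulation {m : ℕ} (D : Finset (Finset (Fin m))) : Prop where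
  card_eq_three : ∀ t ∈ D, t.card = 3
  card_add_two : D.card + 2 = m
  noncrossing : ∀ s ∈ D, ∀ t ∈ D, ∀ a ∈ s, ∀ c ∈ s, ∀ b ∈ t, ∀ d ∈ t,
    ¬ (a < b ∧ b < c ∧ c < d)

/-- `K` arises from the triple system `T` and one further polygonal cell, whose boundary is the
closed walk `w`, as follows. A cycle with vertices `Sum.inr i` is placed in the cell, the annulus
between it and the boundary of the cell is triangulated by the zigzag triangles
`w i, w (i + 1), i` and `w (i + 1), i, i + 1`, and the inner polygon is triangulated by `D`. The
triangles of `K` are exactly those of `T`, of the annulus and of `D`. -/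
def IsZigzagCompletion {V : Type*} [DecidableEq V] {m : ℕ} (T : AbstractSimplicialComplex V)
    (w : Fin m → V) (D : Finset (Finset (Fin m))) (K : AbstractSimplicialComplex (V ⊕ Fin m)) :
    Prop :=
  ∀ t : Finset (V ⊕ Fin m), t ∈ K ∧ t.card = 3 ↔
    (∃ s ∈ T, s.card = 3 ∧ t = s.map Function.Embedding.inl) ∨
    (∃ i, t = {Sum.inl (w i), Sum.inl (w (finRotate m i)), Sum.inr i}) ∨
    (∃ i, t = {Sum.inl (w (finRotate m i)), Sum.inr i, Sum.inr (finRotate m i)}) ∨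
    (∃ s ∈ D, t = s.map Function.Embedding.inr)

/-- `K` is a triangulated closed surface obtained from an embedding of `T` (on `n` points) with
exactly one further, polygonal, face, bounded by an Eulerian circuit of the complete graph, by
triangulating that face by a zigzag annulus and a disk; it has the stated face vector and Euler
characteristic, and its 2-chromatic number is at least that of `T`. -/
structure IsSurfaceExtension {n : ℕ} (T : AbstractSimplicialComplex (Fin n))
    (K : AbstractSimplicialComplex (Fin n ⊕ Fin (n.choose 2))) : Prop where
  isClosedSurface : K.IsClosedSurface
  subcomplex : ∀ t ∈ T, t.map Function.Embedding.inl ∈ K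
  exists_zigzag : ∃ (w : Fin (n.choose 2) → Fin n) (D : Finset (Finset (Fin (n.choose 2)))),
    IsEulerianCircuit w ∧ IsPolygonTriangulation D ∧ IsZigzagCompletion T w D K
  faceNumber_zero : (K.faceNumber 0 : ℚ) = n + n.choose 2
  faceNumber_one : (K.faceNumber 1 : ℚ) = 5 * n.choose 2 - 3
  faceNumber_two : (K.faceNumber 2 : ℚ) = 1 / 3 * n.choose 2 + 3 * n.choose 2 - 2
  eulerChar_eq : (K.eulerChar : ℚ) = 2 - 1 / 3 * (n - 1) * (n - 3)
  chromaticNumber_le : T.chromaticNumber 2 ≤ K.chromaticNumber 2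

end AbstractSimplicialComplex

/-!
The heart of the matter is the construction of an Eulerian circuit of the complete graph that bounds
a single cell complementary to the triple system `T`, so that `T` and this cell form a closed
surface. The circuit is built one triple at a time. For the triples through a base point `o` the
walk goes around the petals of a flower (`IsTour.append_star`). After that it visits every point,
and a further triple `x`, `y`, `z` is added by cutting the walk at occurrences of its three points:
`P x A y B z C` becomes `P x y B z x A y z C` (`IsTour.insert_coherent`). In terms of
surfaces, a new triangle is attached at three corners of the unique face, in the cyclic order that
keeps the complement a single face. In the link of `x` a passage of the walk is replaced by a path
across the new triangle, so links stay connected. All old steps keep their direction and the new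
triple is traversed cyclically, hence the resulting surface is orientable. If `n > 3`, some triple
avoids `o`. Adding it last in the form `P x y A⁻¹ x z B⁻¹ y z C` (`IsTour.insert_incoherent`) makes
the walk leave `x` along both sides of a triangle, and the surface becomes non-orientable.

The cell is subdivided by the zigzag annulus and a fan (`zigzag`). That every edge lies in two
triangles is checked by the types of its ends (`hasTwoTriangles_zigzag`); connectedness of the links
of old vertices is inherited from the circuit (`link_zigzag_inl`). With degree two this says that
links are cycles. The number of edges follows from the number of triangles by double counting.
Orientations propagate along the annulus, which decides orientability (`isOrientable_zigzag`,
`not_isOrientable_zigzag`). A colouring of the surface restricts to `T`, so it remains to find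
triple systems of large chromatic number. These are the projective spaces over the field with two
elements, by Ramsey's theorem for triangles (`exists_isSteinerTripleSystem_le_chromaticNumber`).
-/

/-! ### Windows in lists -/

namespace List

variable {V : Type*}

/-- A window of length two does not straddle an entry at which the list is cut. -/
theorem pair_infix_split {a b c : V} {P Q : List V} (h : [a, b] <:+: P ++ c :: Q) :
    [a, b] <:+: P ++ [c] ∨ [a, b] <:+: c :: Q := by
  induction P with
  | nil => right; simpa using h
  | cons p P ih =>
    rw [cons_append, infix_cons_iff] at h
    rcases h with h | h
    · left
      cases P with
      | nil => simp_all
      | cons p' P => simp_all [infix_cons_iff]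
    · rcases ih h with h | h
      · exact Or.inl (infix_cons h)
      · exact Or.inr h

/-- A window of length three straddles an entry at which the list is cut only if that entry is its
middle. -/
theorem triple_infix_split {a v b c : V} {P Q : List V} (h : [a, v, b] <:+: P ++ c :: Q) :
    [a, v, b] <:+: P ++ [c] ∨ [a, v, b] <:+: c :: Q ∨
      (v = c ∧ (∃ P', P = P' ++ [a]) ∧ ∃ Q', Q = b :: Q') := by
  induction P with
  | nil => right; left; simpa using h
  | cons p P ih =>
    rw [cons_append, infix_cons_iff] at h
    rcases h with h | h
    · match P, h with
      | [], h =>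
        right; right
        simp only [nil_append, cons_prefix_cons] at h
        obtain ⟨rfl, rfl, Q', hQ'⟩ := h
        exact ⟨rfl, ⟨[], rfl⟩, Q', hQ'.symm⟩
      | [q], h => left; simp_all
      | q :: r :: P, h => left; simp_all [infix_cons_iff]
    · rcases ih h with h | h | ⟨hv, ⟨P', rfl⟩, hQ⟩
      · exact Or.inl (infix_cons h)
      · exact Or.inr (Or.inl h)
      · exact Or.inr (Or.inr ⟨hv, ⟨p :: P', rfl⟩, hQ⟩)

/-- A list containing three given points can be cut at one occurrence of each; the order in which
the three points occur names them `x`, `y`, `z`. -/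
theorem exists_split_three [DecidableEq V] {L : List V} {t : Finset V} (ht : t.card = 3)
    (hL : ∀ x ∈ t, x ∈ L) :
    ∃ x y z P A B C, L = P ++ x :: (A ++ y :: (B ++ z :: C)) ∧ t = {x, y, z} ∧
      x ≠ y ∧ x ≠ z ∧ y ≠ z := by
  have two : ∀ (u v : V) (M : List V), u ≠ v → u ∈ M → v ∈ M →
      (∃ A B C, M = A ++ u :: (B ++ v :: C)) ∨ ∃ A B C, M = A ++ v :: (B ++ u :: C) := by
    intro u v M huv hu hv
    obtain ⟨A, B, rfl⟩ := append_of_mem hu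
    rcases mem_append.1 hv with h | h
    · obtain ⟨A', B', rfl⟩ := append_of_mem h
      exact Or.inr ⟨A', B', B, by simp⟩
    · obtain ⟨A', B', rfl⟩ := append_of_mem ((mem_cons.1 h).resolve_left huv.symm)
      exact Or.inl ⟨A, A', B', rfl⟩
  have key : ∀ (u v z : V) (A B C : List V), u ≠ v → u ≠ z → v ≠ z → t = {u, v, z} →
      z ∈ A ++ u :: (B ++ v :: C) →
      ∃ x' y' z' P A' B' C', A ++ u :: (B ++ v :: C) = P ++ x' :: (A' ++ y' :: (B' ++ z' :: C')) ∧
        t = {x', y', z'} ∧ x' ≠ y' ∧ x' ≠ z' ∧ y' ≠ z' := by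
    intro u v z A B C huv huz hvz ht h
    simp only [mem_append, mem_cons, huz.symm, hvz.symm, false_or] at h
    rcases h with h | h | h
    · obtain ⟨A', B', rfl⟩ := append_of_mem h
      exact ⟨z, u, v, A', B', B, C, by simp, by grind, huz.symm, hvz.symm, huv⟩
    · obtain ⟨A', B', rfl⟩ := append_of_mem h
      exact ⟨u, z, v, A, A', B', C, by simp, by grind, huz, huv, hvz.symm⟩
    · obtain ⟨A', B', rfl⟩ := append_of_mem h
      exact ⟨u, v, z, A, B, A', B', by simp, ht, huv, huz, hvz⟩
  obtain ⟨x, y, z, hxy, hxz, hyz, rfl⟩ := Finset.card_eq_three.1 ht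
  rcases two x y L hxy (hL x (by simp)) (hL y (by simp)) with ⟨A, B, C, rfl⟩ | ⟨A, B, C, rfl⟩
  · exact key x y z A B C hxy hxz hyz rfl (hL z (by simp))
  · exact key y x z A B C hxy.symm hyz hxz (by grind) (hL z (by simp))

end List

/-! ### Tours of a family of triples -/

section Tours

variable {V : Type*} [DecidableEq V]

/-- One step in the link of `v` in the polyhedral complex with the triangles `S` and a further cell
bounded by the walk `L`: the neighbours `a` and `b` of `v` belong to a common triangle at `v`, or
`L` passes from `a` through `v` to `b`. -/
def LinkStep (S : Finset (Finset V)) (L : List V) (v a b : V) : Prop :=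
  {v, a, b} ∈ S ∨ [a, v, b] <:+: L

/-- The closed walk `L`, written as a list that begins and ends with the base point `o`, bounds a
single cell complementary to the triangles of `S`: it has one step for each edge of each triple, all
its steps are such edges, it traverses all of them, and the link of every vertex is connected.
The passage of the walk through `o` where the list closes up is not a window of `L`; the links are
required to be connected even without it. -/
structure IsTour (o : V) (S : Finset (Finset V)) (L : List V) : Prop where
  head : L.head? = some o
  last : L.getLast? = some o
  length : L.length = 3 * S.card + 1
  chain : L.IsChain (fun a b => a ≠ b ∧ ∃ t ∈ S, a ∈ t ∧ b ∈ t)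
  traverses : ∀ t ∈ S, ∀ a ∈ t, ∀ b ∈ t, a ≠ b → [a, b] <:+: L ∨ [b, a] <:+: L
  link : ∀ v a b, a ≠ v → b ≠ v → (∃ t ∈ S, v ∈ t ∧ a ∈ t) → (∃ t ∈ S, v ∈ t ∧ b ∈ t) →
    Relation.EqvGen (LinkStep S L v) a b

/-- The walk `L` runs around every triple of `S` in a cyclic direction, so that the triangles and
the cell bounded by `L` can be oriented coherently. -/
def IsCoherent (S : Finset (Finset V)) (L : List V) : Prop :=
  ∀ t ∈ S, ∃ a b c, t = {a, b, c} ∧ [a, b] <:+: L ∧ [b, c] <:+: L ∧ [c, a] <:+: L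

/-- Links stay connected when the triple `t` is added, provided that old link steps remain
connections (`h3`), and that at each old vertex of `t` some old neighbour becomes connected to a
further vertex of `t` (`hp`). -/
theorem IsTour.link_insert {o : V} {S : Finset (Finset V)} {L L' : List V} (h : IsTour o S L)
    {t : Finset V} (ht : t.card = 3)
    (h3 : ∀ v a b, [a, v, b] <:+: L → Relation.EqvGen (LinkStep (insert t S) L' v) a b)
    (hp : ∀ v ∈ t, ∀ s ∈ S, v ∈ s → ∃ p, p ≠ v ∧ (∃ s ∈ S, v ∈ s ∧ p ∈ s) ∧
      ∃ q ∈ t, q ≠ v ∧ Relation.EqvGen (LinkStep (insert t S) L' v) p q) :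
    ∀ v a b, a ≠ v → b ≠ v → (∃ s ∈ insert t S, v ∈ s ∧ a ∈ s) →
      (∃ s ∈ insert t S, v ∈ s ∧ b ∈ s) →
      Relation.EqvGen (LinkStep (insert t S) L' v) a b := by
  intro v
  have old : ∀ a b, a ≠ v → b ≠ v → (∃ s ∈ S, v ∈ s ∧ a ∈ s) → (∃ s ∈ S, v ∈ s ∧ b ∈ s) →
      Relation.EqvGen (LinkStep (insert t S) L' v) a b := by
    intro a b ha hb hSa hSb
    have hab := h.link v a b ha hb hSa hSb
    clear ha hb hSa hSb
    induction hab with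
    | rel a b hab =>
      rcases hab with hab | hab
      · exact .rel _ _ (Or.inl (Finset.mem_insert_of_mem hab))
      · exact h3 v a b hab
    | refl a => exact .refl a
    | symm a b _ ih => exact ih.symm
    | trans a b c _ _ ih1 ih2 => exact ih1.trans _ _ _ ih2
  have new : ∀ a b, a ≠ v → b ≠ v → v ∈ t → a ∈ t → b ∈ t →
      Relation.EqvGen (LinkStep (insert t S) L' v) a b := by
    intro a b ha hb hv hat hbt
    rcases eq_or_ne a b with rfl | hab
    · exact .refl a
    · refine .rel _ _ (Or.inl (Finset.mem_insert.2 (Or.inl ?_)))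
      refine Finset.eq_of_subset_of_card_le (by grind) ?_
      rw [ht, Finset.card_eq_three.2 ⟨v, a, b, ha.symm, hb.symm, hab, rfl⟩]
  have mix : ∀ a b, a ≠ v → b ≠ v → v ∈ t → a ∈ t → (∃ s ∈ S, v ∈ s ∧ b ∈ s) →
      Relation.EqvGen (LinkStep (insert t S) L' v) a b := by
    intro a b ha hb hv hat hb'
    obtain ⟨s, hs, hvs, hbs⟩ := hb'
    obtain ⟨p, hpv, hps, q, hq, hqv, hpq⟩ := hp v hv s hs hvs
    exact ((new a q ha hqv hv hat hq).trans _ _ _ hpq.symm).trans _ _ _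
      (old p b hpv hb hps ⟨s, hs, hvs, hbs⟩)
  rintro a b ha hb ⟨s, hs, hvs, has⟩ ⟨s', hs', hvs', hbs'⟩
  rcases Finset.mem_insert.1 hs with hst | hs <;> rcases Finset.mem_insert.1 hs' with hst' | hs'
  · exact new a b ha hb (hst ▸ hvs) (hst ▸ has) (hst' ▸ hbs')
  · exact mix a b ha hb (hst ▸ hvs) (hst ▸ has) ⟨s', hs', hvs', hbs'⟩
  · exact (mix b a hb ha (hst' ▸ hvs') (hst' ▸ hbs') ⟨s, hs, hvs, has⟩).symm
  · exact old a b ha hb ⟨s, hs, hvs, has⟩ ⟨s', hs', hvs', hbs'⟩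

theorem IsTour.chain_insert {S : Finset (Finset V)} {L : List V}
    (h : L.IsChain (fun a b => a ≠ b ∧ ∃ t ∈ S, a ∈ t ∧ b ∈ t)) (t : Finset V) :
    L.IsChain (fun a b => a ≠ b ∧ ∃ s ∈ insert t S, a ∈ s ∧ b ∈ s) :=
  h.imp fun _ _ ⟨hab, s, hs, h⟩ => ⟨hab, s, Finset.mem_insert_of_mem hs, h⟩

/-- A tour cut at `x`, `y` and `z` into the segments `P x`, `x A y`, `y B z` and `z C` can be
replaced by `L'`, a rearrangement of these segments, possibly reversed, along the three sides of the
new triple, if at each of `x`, `y`, `z` both ends of the old segments now continue along a new side: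
the old passage through that point is then replaced by a path in the link across the new
triangle. -/
theorem IsTour.splice {o : V} {S : Finset (Finset V)} {P A B C L' : List V} {x y z : V}
    (h : IsTour o S (P ++ x :: (A ++ y :: (B ++ z :: C)))) (hxo : x ≠ o)
    (hxy : x ≠ y) (hxz : x ≠ z) (hyz : y ≠ z) (hS : {x, y, z} ∉ S)
    (head : L'.head? = some o) (last : L'.getLast? = some o)
    (length : L'.length = (P ++ x :: (A ++ y :: (B ++ z :: C))).length + 3)
    (chain : ∀ R : V → V → Prop, (∀ a b, R a b → R b a) → (P ++ [x]).IsChain R →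
      (x :: (A ++ [y])).IsChain R →
      (y :: (B ++ [z])).IsChain R → (z :: C).IsChain R → R x y → R y z → R z x → L'.IsChain R)
    (pairs : ∀ a b, [a, b] <:+: P ++ [x] ∨ [a, b] <:+: x :: (A ++ [y]) ∨
      [a, b] <:+: y :: (B ++ [z]) ∨ [a, b] <:+: z :: C ∨ (a = x ∧ b = y) ∨ (a = y ∧ b = z) ∨
      (a = z ∧ b = x) → [a, b] <:+: L' ∨ [b, a] <:+: L')
    (windows : ∀ a v b, [a, v, b] <:+: P ++ [x] ∨ [a, v, b] <:+: x :: (A ++ [y]) ∨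
      [a, v, b] <:+: y :: (B ++ [z]) ∨ [a, v, b] <:+: z :: C →
      [a, v, b] <:+: L' ∨ [b, v, a] <:+: L')
    (hx : ∀ a, (∃ P', P = P' ++ [a]) ∨ (∃ Q M, A ++ y :: M = a :: Q) →
      ∃ q, (q = y ∨ q = z) ∧ ([a, x, q] <:+: L' ∨ [q, x, a] <:+: L'))
    (hy : ∀ a, (∃ P', x :: A = P' ++ [a]) ∨ (∃ Q M, B ++ z :: M = a :: Q) →
      ∃ q, (q = x ∨ q = z) ∧ ([a, y, q] <:+: L' ∨ [q, y, a] <:+: L'))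
    (hz : ∀ a, (∃ P', y :: B = P' ++ [a]) ∨ (∃ Q, C = a :: Q) →
      ∃ q, (q = x ∨ q = y) ∧ ([a, z, q] <:+: L' ∨ [q, z, a] <:+: L')) :
    IsTour o (insert {x, y, z} S) L' := by
  have tri : ({x, y, z} : Finset V).card = 3 := Finset.card_eq_three.2 ⟨x, y, z, hxy, hxz, hyz, rfl⟩
  have win : ∀ {v a b}, [a, v, b] <:+: L' ∨ [b, v, a] <:+: L' →
      Relation.EqvGen (LinkStep (insert {x, y, z} S) L' v) a b := fun h =>
    h.elim (fun h => .rel _ _ (Or.inr h)) fun h => .symm _ _ (.rel _ _ (Or.inr h))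
  have new : ∀ {v a b}, ({v, a, b} : Finset V) = {x, y, z} →
      Relation.EqvGen (LinkStep (insert {x, y, z} S) L' v) a b :=
    fun h => .rel _ _ (Or.inl (h ▸ Finset.mem_insert_self _ _))
  have exy : Relation.EqvGen (LinkStep (insert {x, y, z} S) L' z) x y := new (by grind)
  have eyz : Relation.EqvGen (LinkStep (insert {x, y, z} S) L' x) y z := new (by grind)
  have ezx : Relation.EqvGen (LinkStep (insert {x, y, z} S) L' y) z x := new (by grind)
  have h3 : ∀ v a b, [a, v, b] <:+: P ++ x :: (A ++ y :: (B ++ z :: C)) →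
      Relation.EqvGen (LinkStep (insert {x, y, z} S) L' v) a b := by
    have join : ∀ {v a b s t : V},
        (∃ q, (q = s ∨ q = t) ∧ ([a, v, q] <:+: L' ∨ [q, v, a] <:+: L')) →
        (∃ q, (q = s ∨ q = t) ∧ ([b, v, q] <:+: L' ∨ [q, v, b] <:+: L')) →
        Relation.EqvGen (LinkStep (insert {x, y, z} S) L' v) s t →
        Relation.EqvGen (LinkStep (insert {x, y, z} S) L' v) a b := by
      rintro v a b s t ⟨q, hq, haq⟩ ⟨r, hr, hbr⟩ hst
      refine ((win haq).trans _ _ _ ?_).trans _ _ _ (win hbr).symm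
      rcases hq with rfl | rfl <;> rcases hr with rfl | rfl
      exacts [.refl _, hst, hst.symm, .refl _]
    intro v a b hab
    rcases List.triple_infix_split hab with hab | hab | ⟨rfl, hP', Q, hQ⟩
    · exact win (windows _ _ _ (Or.inl hab))
    · rw [← List.cons_append] at hab
      rcases List.triple_infix_split hab with hab | hab | ⟨rfl, hP', Q, hQ⟩
      · exact win (windows _ _ _ (Or.inr (Or.inl hab)))
      · rw [← List.cons_append] at hab
        rcases List.triple_infix_split hab with hab | hab | ⟨rfl, hP', hQ⟩
        · exact win (windows _ _ _ (Or.inr (Or.inr (Or.inl hab))))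
        · exact win (windows _ _ _ (Or.inr (Or.inr (Or.inr hab))))
        · exact join (hz _ (Or.inl hP')) (hz _ (Or.inr hQ)) exy
      · exact join (hy _ (Or.inl hP')) (hy _ (Or.inr ⟨_, _, hQ⟩)) ezx.symm
    · exact join (hx _ (Or.inl hP')) (hx _ (Or.inr ⟨_, _, hQ⟩)) eyz
  obtain ⟨cP, hch⟩ := List.isChain_split.1 h.chain
  rw [← List.cons_append] at hch
  obtain ⟨cA, hch⟩ := List.isChain_split.1 hch
  rw [← List.cons_append] at hch
  obtain ⟨cB, cC⟩ := List.isChain_split.1 hch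
  have pre : ∀ {M : List V} {u : V}, M ≠ [] →
      (M ++ [u]).IsChain (fun a b => a ≠ b ∧ ∃ t ∈ S, a ∈ t ∧ b ∈ t) →
      ∃ p, (∃ M', M = M' ++ [p]) ∧ p ≠ u ∧ ∃ t ∈ S, u ∈ t ∧ p ∈ t := by
    intro M u hM hc
    obtain ⟨M', p, rfl⟩ := List.eq_nil_or_concat' M |>.resolve_left hM
    rw [List.append_assoc, List.singleton_append, List.isChain_split] at hc
    obtain ⟨hpu, t, ht, hpt, hut⟩ := List.isChain_pair.1 hc.2
    exact ⟨p, ⟨M', rfl⟩, hpu, t, ht, hut, hpt⟩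
  have hP : P ≠ [] := by
    rintro rfl
    exact hxo (by simpa using h.head)
  refine ⟨head, last, ?_, ?_, ?_, ?_⟩
  · rw [length, h.length, Finset.card_insert_of_notMem hS]
    ring
  · refine chain _ ?_ (IsTour.chain_insert cP _) (IsTour.chain_insert cA _)
      (IsTour.chain_insert cB _) (IsTour.chain_insert cC _)
      ⟨hxy, _, Finset.mem_insert_self _ _, by simp⟩ ⟨hyz, _, Finset.mem_insert_self _ _, by simp⟩
      ⟨hxz.symm, _, Finset.mem_insert_self _ _, by simp⟩
    rintro a b ⟨hab, t, ht, ha, hb⟩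
    exact ⟨hab.symm, t, ht, hb, ha⟩
  · intro t ht a ha b hb hab
    rcases Finset.mem_insert.1 ht with rfl | ht
    · simp only [Finset.mem_insert, Finset.mem_singleton] at ha hb
      have hxy' := pairs x y (by simp)
      have hyz' := pairs y z (by simp)
      have hzx' := pairs z x (by simp)
      rcases ha with rfl | rfl | rfl <;> rcases hb with rfl | rfl | rfl <;> tauto
    · have h2 : ∀ a b, [a, b] <:+: P ++ x :: (A ++ y :: (B ++ z :: C)) →
          [a, b] <:+: L' ∨ [b, a] <:+: L' := by
        intro a b hab
        rcases List.pair_infix_split hab with hab | hab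
        · exact pairs _ _ (Or.inl hab)
        rw [← List.cons_append] at hab
        rcases List.pair_infix_split hab with hab | hab
        · exact pairs _ _ (Or.inr (Or.inl hab))
        rw [← List.cons_append] at hab
        rcases List.pair_infix_split hab with hab | hab
        · exact pairs _ _ (Or.inr (Or.inr (Or.inl hab)))
        · exact pairs _ _ (Or.inr (Or.inr (Or.inr (Or.inl hab))))
      exact (h.traverses t ht a ha b hb hab).elim (h2 _ _) fun hba => (h2 _ _ hba).symm
  · refine h.link_insert tri h3 fun v hv _ _ _ => ?_
    simp only [Finset.mem_insert, Finset.mem_singleton] at hv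
    rcases hv with rfl | rfl | rfl
    · obtain ⟨p, hM, hp, ht⟩ := pre hP cP
      obtain ⟨q, hq, hw⟩ := hx p (Or.inl hM)
      exact ⟨p, hp, ht, q, by grind, by grind, win hw⟩
    · obtain ⟨p, hM, hp, ht⟩ := pre (by simp) cA
      obtain ⟨q, hq, hw⟩ := hy p (Or.inl hM)
      exact ⟨p, hp, ht, q, by grind, by grind, win hw⟩
    · obtain ⟨p, hM, hp, ht⟩ := pre (by simp) cB
      obtain ⟨q, hq, hw⟩ := hz p (Or.inl hM)
      exact ⟨p, hp, ht, q, by grind, by grind, win hw⟩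

/-- Adding a triple to a tour `P x A y B z C` with all old segments traversed in their old
direction: the new tour `P x y B z x A y z C` runs around the triple as `x → y → z → x`. -/
theorem IsTour.insert_coherent {o : V} {S : Finset (Finset V)} {P A B C : List V} {x y z : V}
    (h : IsTour o S (P ++ x :: (A ++ y :: (B ++ z :: C)))) (hxo : x ≠ o)
    (hxy : x ≠ y) (hxz : x ≠ z) (hyz : y ≠ z) (hS : {x, y, z} ∉ S) :
    IsTour o (insert {x, y, z} S) (P ++ x :: y :: (B ++ z :: x :: (A ++ y :: z :: C))) ∧
    (IsCoherent S (P ++ x :: (A ++ y :: (B ++ z :: C))) → IsCoherent (insert {x, y, z} S)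
      (P ++ x :: y :: (B ++ z :: x :: (A ++ y :: z :: C)))) := by
  set L' := P ++ x :: y :: (B ++ z :: x :: (A ++ y :: z :: C)) with hL'
  have sP : P ++ [x] <:+: L' := ⟨[], y :: (B ++ z :: x :: (A ++ y :: z :: C)), by simp [hL']⟩
  have sA : x :: (A ++ [y]) <:+: L' := ⟨P ++ x :: y :: (B ++ [z]), z :: C, by simp [hL']⟩
  have sB : y :: (B ++ [z]) <:+: L' := ⟨P ++ [x], x :: (A ++ y :: z :: C), by simp [hL']⟩
  have sC : z :: C <:+: L' := ⟨P ++ x :: y :: (B ++ z :: x :: (A ++ [y])), [], by simp [hL']⟩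
  have hxy' : [x, y] <:+: L' := ⟨P, B ++ z :: x :: (A ++ y :: z :: C), by simp [hL']⟩
  have hzx' : [z, x] <:+: L' := ⟨P ++ x :: y :: B, A ++ y :: z :: C, by simp [hL']⟩
  have hyz' : [y, z] <:+: L' := ⟨P ++ x :: y :: (B ++ z :: x :: A), C, by simp [hL']⟩
  refine ⟨h.splice hxo hxy hxz hyz hS ?_ ?_ ?_ ?_ ?_ ?_ ?_ ?_ ?_, ?_⟩
  · have := h.head
    cases P <;> simp_all
  · have e : L' = (P ++ x :: y :: (B ++ z :: x :: (A ++ [y]))) ++ z :: C := by simp [hL']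
    rw [e, List.getLast?_append_of_ne_nil _ (by simp)]
    have e' : P ++ x :: (A ++ y :: (B ++ z :: C)) = (P ++ x :: (A ++ y :: B)) ++ z :: C := by simp
    rw [← h.last, e', List.getLast?_append_of_ne_nil _ (by simp)]
  · simp [hL']
    omega
  · intro R hR cP cA cB cC rxy ryz rzx
    rw [hL', List.isChain_split]
    refine ⟨cP, List.isChain_cons_cons.2 ⟨rxy, ?_⟩⟩
    rw [← List.cons_append, List.isChain_split]
    refine ⟨cB, List.isChain_cons_cons.2 ⟨rzx, ?_⟩⟩
    rw [← List.cons_append, List.isChain_split]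
    exact ⟨cA, List.isChain_cons_cons.2 ⟨ryz, cC⟩⟩
  · rintro a b (h | h | h | h | ⟨rfl, rfl⟩ | ⟨rfl, rfl⟩ | ⟨rfl, rfl⟩)
    exacts [Or.inl (h.trans sP), Or.inl (h.trans sA), Or.inl (h.trans sB), Or.inl (h.trans sC),
      Or.inl hxy', Or.inl hyz', Or.inl hzx']
  · rintro a v b (h | h | h | h)
    exacts [Or.inl (h.trans sP), Or.inl (h.trans sA), Or.inl (h.trans sB), Or.inl (h.trans sC)]
  · rintro a (⟨P', rfl⟩ | ⟨Q, M, hQ⟩)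
    · exact ⟨y, Or.inl rfl, Or.inl ⟨P', B ++ z :: x :: (A ++ y :: z :: C), by simp [hL']⟩⟩
    · refine ⟨z, Or.inr rfl, Or.inr ⟨P ++ x :: y :: B, (A ++ y :: z :: C).tail, ?_⟩⟩
      cases A <;> simp_all
  · rintro a (⟨M, hM⟩ | ⟨Q, M, hQ⟩)
    · refine ⟨z, Or.inr rfl, Or.inl ⟨P ++ x :: y :: (B ++ z :: M), C, ?_⟩⟩
      have : L' = P ++ x :: y :: (B ++ z :: ((x :: A) ++ y :: z :: C)) := by simp [hL']
      rw [this, hM]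
      simp
    · refine ⟨x, Or.inl rfl, Or.inr ⟨P, (B ++ z :: x :: (A ++ y :: z :: C)).tail, ?_⟩⟩
      cases B <;> simp_all
  · rintro a (⟨M, hM⟩ | ⟨Q, rfl⟩)
    · refine ⟨x, Or.inl rfl, Or.inl ⟨P ++ x :: M, A ++ y :: z :: C, ?_⟩⟩
      have : L' = P ++ x :: ((y :: B) ++ z :: x :: (A ++ y :: z :: C)) := by simp [hL']
      rw [this, hM]
      simp
    · exact ⟨y, Or.inr rfl, Or.inr ⟨P ++ x :: y :: (B ++ z :: x :: A), Q, by simp [hL']⟩⟩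
  · intro hco t ht
    have h2 : ∀ {a b}, [a, b] <:+: P ++ x :: (A ++ y :: (B ++ z :: C)) → [a, b] <:+: L' := by
      intro a b hab
      rcases List.pair_infix_split hab with hab | hab
      · exact hab.trans sP
      rw [← List.cons_append] at hab
      rcases List.pair_infix_split hab with hab | hab
      · exact hab.trans sA
      rw [← List.cons_append] at hab
      rcases List.pair_infix_split hab with hab | hab
      · exact hab.trans sB
      · exact hab.trans sC
    rcases Finset.mem_insert.1 ht with rfl | ht
    · exact ⟨x, y, z, rfl, hxy', hyz', hzx'⟩
    · obtain ⟨a, b, c, rfl, hab, hbc, hca⟩ := hco t ht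
      exact ⟨a, b, c, rfl, h2 hab, h2 hbc, h2 hca⟩

/-- Adding a triple to a tour `P x A y B z C` with the segments `A` and `B` reversed: the new tour
leaves `x` towards both `y` and `z`, so that it cannot be oriented coherently with the triple. -/
theorem IsTour.insert_incoherent {o : V} {S : Finset (Finset V)} {P A B C : List V} {x y z : V}
    (h : IsTour o S (P ++ x :: (A ++ y :: (B ++ z :: C)))) (hxo : x ≠ o)
    (hxy : x ≠ y) (hxz : x ≠ z) (hyz : y ≠ z) (hS : {x, y, z} ∉ S) :
    IsTour o (insert {x, y, z} S)
      (P ++ x :: y :: (A.reverse ++ x :: z :: (B.reverse ++ y :: z :: C))) := by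
  set L' := P ++ x :: y :: (A.reverse ++ x :: z :: (B.reverse ++ y :: z :: C)) with hL'
  have sP : P ++ [x] <:+: L' := ⟨[], (y :: (A.reverse ++ x :: z :: (B.reverse ++ y :: z :: C))),
    by simp [hL']⟩
  have sA : (x :: (A ++ [y])).reverse <:+: L' := ⟨P ++ [x], z :: (B.reverse ++ y :: z :: C),
    by simp [hL']⟩
  have sB : (y :: (B ++ [z])).reverse <:+: L' := ⟨P ++ x :: y :: (A.reverse ++ [x]), z :: C,
    by simp [hL']⟩
  have sC : z :: C <:+: L' := ⟨P ++ x :: y :: (A.reverse ++ x :: z :: (B.reverse ++ [y])), [],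
    by simp [hL']⟩
  have hxy' : [x, y] <:+: L' := ⟨P, A.reverse ++ x :: z :: (B.reverse ++ y :: z :: C),
    by simp [hL']⟩
  have hxz' : [x, z] <:+: L' := ⟨P ++ x :: y :: A.reverse, B.reverse ++ y :: z :: C,
    by simp [hL']⟩
  have hyz' : [y, z] <:+: L' := ⟨P ++ x :: y :: (A.reverse ++ x :: z :: B.reverse), C,
    by simp [hL']⟩
  refine h.splice hxo hxy hxz hyz hS ?_ ?_ ?_ ?_ ?_ ?_ ?_ ?_ ?_
  · have := h.head
    cases P <;> simp_all
  · have e : L' = (P ++ x :: y :: (A.reverse ++ x :: z :: (B.reverse ++ [y]))) ++ z :: C := by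
      simp [hL']
    rw [e, List.getLast?_append_of_ne_nil _ (by simp)]
    have e' : P ++ x :: (A ++ y :: (B ++ z :: C)) = (P ++ x :: (A ++ y :: B)) ++ z :: C := by simp
    rw [← h.last, e', List.getLast?_append_of_ne_nil _ (by simp)]
  · simp [hL']
    omega
  · intro R hR cP cA cB cC rxy ryz rzx
    have hrev : ∀ {M : List V}, M.IsChain R → M.reverse.IsChain R := fun hM =>
      List.isChain_reverse.2 (hM.imp hR)
    rw [hL', List.isChain_split]
    refine ⟨cP, List.isChain_cons_cons.2 ⟨rxy, ?_⟩⟩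
    rw [← List.cons_append, List.isChain_split]
    refine ⟨by simpa using hrev cA, List.isChain_cons_cons.2 ⟨hR _ _ rzx, ?_⟩⟩
    rw [← List.cons_append, List.isChain_split]
    exact ⟨by simpa using hrev cB, List.isChain_cons_cons.2 ⟨ryz, cC⟩⟩
  · have rev : ∀ {a b : V} {M : List V}, [a, b] <:+: M → M.reverse <:+: L' → [b, a] <:+: L' :=
      fun h hM => (List.reverse_infix.2 h).trans hM
    rintro a b (h | h | h | h | ⟨rfl, rfl⟩ | ⟨rfl, rfl⟩ | ⟨rfl, rfl⟩)
    exacts [Or.inl (h.trans sP), Or.inr (rev h sA), Or.inr (rev h sB), Or.inl (h.trans sC),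
      Or.inl hxy', Or.inl hyz', Or.inr hxz']
  · have rev : ∀ {a v b : V} {M : List V}, [a, v, b] <:+: M → M.reverse <:+: L' →
        [b, v, a] <:+: L' := fun h hM => (List.reverse_infix.2 h).trans hM
    rintro a v b (h | h | h | h)
    exacts [Or.inl (h.trans sP), Or.inr (rev h sA), Or.inr (rev h sB), Or.inl (h.trans sC)]
  · rintro a (⟨P', rfl⟩ | ⟨Q, M, hQ⟩)
    · exact ⟨y, Or.inl rfl, Or.inl ⟨P', A.reverse ++ x :: z :: (B.reverse ++ y :: z :: C),
        by simp [hL']⟩⟩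
    · refine ⟨z, Or.inr rfl, Or.inl ⟨P ++ x :: (A ++ [y]).tail.reverse,
        B.reverse ++ y :: z :: C, ?_⟩⟩
      cases A <;> simp_all
  · rintro a (⟨M, hM⟩ | ⟨Q, M, hQ⟩)
    · refine ⟨x, Or.inl rfl, Or.inr ⟨P, M.reverse ++ z :: (B.reverse ++ y :: z :: C), ?_⟩⟩
      have : L' = P ++ x :: y :: ((x :: A).reverse ++ z :: (B.reverse ++ y :: z :: C)) := by
        simp [hL']
      rw [this, hM]
      simp
    · refine ⟨z, Or.inr rfl, Or.inl ⟨P ++ x :: y :: (A.reverse ++ x :: (B ++ [z]).tail.reverse),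
        C, ?_⟩⟩
      cases B <;> simp_all
  · rintro a (⟨M, hM⟩ | ⟨Q, rfl⟩)
    · refine ⟨x, Or.inl rfl, Or.inr ⟨P ++ x :: y :: A.reverse, M.reverse ++ z :: C, ?_⟩⟩
      have : L' = P ++ x :: y :: (A.reverse ++ x :: z :: ((y :: B).reverse ++ z :: C)) := by
        simp [hL']
      rw [this, hM]
      simp
    · exact ⟨y, Or.inr rfl, Or.inr ⟨P ++ x :: y :: (A.reverse ++ x :: z :: B.reverse), Q,
        by simp [hL']⟩⟩

/-- Adding a triple at the base point whose two other points are new. -/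
theorem IsTour.append_star {o : V} {S : Finset (Finset V)} {L : List V} (h : IsTour o S L)
    {a b : V} (ha : a ≠ o) (hb : b ≠ o) (hab : a ≠ b) (haS : ∀ s ∈ S, a ∉ s)
    (hbS : ∀ s ∈ S, b ∉ s) :
    IsTour o (insert {o, a, b} S) (L ++ [a, b, o]) := by
  have hS : ({o, a, b} : Finset V) ∉ S := fun h => haS _ h (by simp)
  have tri : ({o, a, b} : Finset V).card = 3 :=
    Finset.card_eq_three.2 ⟨o, a, b, ha.symm, hb.symm, hab, rfl⟩
  obtain ⟨M, rfl⟩ : ∃ M, L = M ++ [o] := by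
    rcases List.eq_nil_or_concat' L with rfl | ⟨M, c, rfl⟩
    · simpa using h.head
    · exact ⟨M, by simpa using h.last⟩
  have e : M ++ [o] ++ [a, b, o] = M ++ o :: [a, b, o] := by simp
  refine ⟨?_, by simp, ?_, ?_, ?_, ?_⟩
  · have := h.head
    cases M <;> simp_all
  · rw [Finset.card_insert_of_notMem hS, List.length_append, h.length]
    simp
    ring
  · rw [e, List.isChain_split]
    refine ⟨IsTour.chain_insert h.chain _, ?_⟩
    have r : ∀ {c d}, c ∈ ({o, a, b} : Finset V) → d ∈ ({o, a, b} : Finset V) → c ≠ d →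
        c ≠ d ∧ ∃ s ∈ insert {o, a, b} S, c ∈ s ∧ d ∈ s :=
      fun hc hd hcd => ⟨hcd, _, Finset.mem_insert_self _ _, hc, hd⟩
    simp only [List.isChain_cons_cons, List.isChain_singleton, and_true]
    exact ⟨r (by simp) (by simp) ha.symm, r (by simp) (by simp) hab, r (by simp) (by simp) hb⟩
  · intro t ht c hc d hd hcd
    rcases Finset.mem_insert.1 ht with rfl | ht
    · have h1 : [o, a] <:+: M ++ [o] ++ [a, b, o] := ⟨M, [b, o], by simp⟩
      have h2 : [a, b] <:+: M ++ [o] ++ [a, b, o] := ⟨M ++ [o], [o], by simp⟩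
      have h3 : [b, o] <:+: M ++ [o] ++ [a, b, o] := ⟨M ++ [o, a], [], by simp⟩
      simp only [Finset.mem_insert, Finset.mem_singleton] at hc hd
      rcases hc with rfl | rfl | rfl <;> rcases hd with rfl | rfl | rfl <;> tauto
    · exact (h.traverses t ht c hc d hd hcd).imp List.infix_append_of_infix_left
        List.infix_append_of_infix_left
  · refine h.link_insert tri (fun v c d hcd => .rel _ _ (Or.inr
      (List.infix_append_of_infix_left hcd))) ?_
    intro v hv s hs hvs
    simp only [Finset.mem_insert, Finset.mem_singleton] at hv
    rcases hv with rfl | rfl | rfl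
    · have hM : M ≠ [] := by
        rintro rfl
        have h1 := h.length
        have := Finset.card_pos.2 ⟨s, hs⟩
        rw [List.nil_append, List.length_singleton] at h1
        omega
      obtain ⟨M', p, rfl⟩ := List.eq_nil_or_concat' M |>.resolve_left hM
      have hc := h.chain
      rw [List.append_assoc, List.singleton_append, List.isChain_split] at hc
      obtain ⟨hpu, t, ht, hpt, hut⟩ := List.isChain_pair.1 hc.2
      exact ⟨p, hpu, ⟨t, ht, hut, hpt⟩, a, by simp, ha,
        .rel _ _ (Or.inr ⟨M', [b, v], by simp⟩)⟩
    · exact absurd hvs (haS s hs)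
    · exact absurd hvs (hbS s hs)

theorem IsCoherent.append_star {S : Finset (Finset V)} {L : List V} {o : V} (h : IsCoherent S L)
    (hL : L.getLast? = some o) (a b : V) : IsCoherent (insert {o, a, b} S) (L ++ [a, b, o]) := by
  intro t ht
  rcases Finset.mem_insert.1 ht with rfl | ht
  · obtain ⟨M, rfl⟩ : ∃ M, L = M ++ [o] := by
      rcases List.eq_nil_or_concat' L with rfl | ⟨M, c, rfl⟩
      · simp at hL
      · exact ⟨M, by simpa using hL⟩
    exact ⟨o, a, b, rfl, ⟨M, [b, o], by simp⟩, ⟨M ++ [o], [o], by simp⟩, ⟨M ++ [o, a], [], by simp⟩⟩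
  · obtain ⟨a, b, c, rfl, hab, hbc, hca⟩ := h t ht
    exact ⟨a, b, c, rfl, List.infix_append_of_infix_left hab, List.infix_append_of_infix_left hbc,
      List.infix_append_of_infix_left hca⟩

end Tours

/-! ### Tours of triple systems -/

section Existence

variable {V : Type*} [DecidableEq V]

/-- The blocks of a Steiner triple system: triples such that any two points lie in exactly one. -/
structure IsTripleSystem (𝒯 : Finset (Finset V)) : Prop where
  card_eq : ∀ t ∈ 𝒯, t.card = 3
  exists_mem : ∀ x y, x ≠ y → ∃ t ∈ 𝒯, x ∈ t ∧ y ∈ t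
  unique : ∀ s ∈ 𝒯, ∀ t ∈ 𝒯, ∀ x y, x ≠ y → x ∈ s → y ∈ s → x ∈ t → y ∈ t → s = t

theorem IsTour.mem {o : V} {S : Finset (Finset V)} {L : List V} (h : IsTour o S L)
    {t : Finset V} (ht : t ∈ S) (ht3 : t.card = 3) {x : V} (hx : x ∈ t) : x ∈ L := by
  obtain ⟨y, hy, hyx⟩ := Finset.exists_mem_ne (by omega : 1 < t.card) x
  rcases h.traverses t ht x hx y hy hyx.symm with h | h <;> exact h.subset (by simp)

/-- The triples through the base point `o` are toured petal by petal. -/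
theorem IsTripleSystem.exists_star_tour {𝒯 : Finset (Finset V)} (h𝒯 : IsTripleSystem 𝒯) (o : V)
    (S : Finset (Finset V)) (hS : S ⊆ 𝒯.filter (o ∈ ·)) :
    ∃ L, IsTour o S L ∧ IsCoherent S L := by
  induction S using Finset.induction_on with
  | empty =>
    exact ⟨[o], ⟨rfl, rfl, rfl, .singleton _, by simp, by simp⟩, by simp [IsCoherent]⟩
  | insert t S htS ih =>
    obtain ⟨L, hL, hco⟩ := ih fun s hs => hS (Finset.mem_insert_of_mem hs)
    obtain ⟨ht𝒯, hot⟩ := Finset.mem_filter.1 (hS (Finset.mem_insert_self _ _))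
    obtain ⟨a, b, hab, hab'⟩ := Finset.card_eq_two.1
      (show (t.erase o).card = 2 by rw [Finset.card_erase_of_mem hot, h𝒯.card_eq t ht𝒯])
    have hao : a ≠ o := fun h => by
      have : o ∈ t.erase o := by rw [hab', ← h]; simp
      simp at this
    have hbo : b ≠ o := fun h => by
      have : o ∈ t.erase o := by rw [hab', ← h]; simp
      simp at this
    obtain rfl : t = {o, a, b} := by rw [← Finset.insert_erase hot, hab']
    have new : ∀ c ∈ ({o, a, b} : Finset V), c ≠ o → ∀ s ∈ S, c ∉ s := by
      intro c hc hco s hs hcs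
      obtain ⟨hs𝒯, hos⟩ := Finset.mem_filter.1 (hS (Finset.mem_insert_of_mem hs))
      have := h𝒯.unique _ hs𝒯 _ ht𝒯 c o hco hcs hos hc hot
      exact htS (this ▸ hs)
    exact ⟨_, hL.append_star hao hbo hab (new a (by simp) hao) (new b (by simp) hbo),
      hco.append_star hL.last a b⟩

/-- As soon as the star of `o` has been toured, the tour visits all points. -/
theorem IsTripleSystem.mem_tour {𝒯 : Finset (Finset V)} (h𝒯 : IsTripleSystem 𝒯) {o : V}
    {R : Finset (Finset V)} {L : List V} (hL : IsTour o (𝒯.filter (o ∈ ·) ∪ R) L) (x : V) :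
    x ∈ L := by
  rcases eq_or_ne o x with rfl | hox
  · exact List.mem_of_mem_head? hL.head
  · obtain ⟨t, ht, hot, hxt⟩ := h𝒯.exists_mem o x hox
    exact hL.mem (Finset.mem_union_left _ (Finset.mem_filter.2 ⟨ht, hot⟩)) (h𝒯.card_eq t ht) hxt

theorem IsTripleSystem.exists_partial_tour {𝒯 : Finset (Finset V)} (h𝒯 : IsTripleSystem 𝒯) (o : V)
    (R : Finset (Finset V)) (hR : R ⊆ 𝒯.filter (o ∉ ·)) :
    ∃ L, IsTour o (𝒯.filter (o ∈ ·) ∪ R) L ∧ IsCoherent (𝒯.filter (o ∈ ·) ∪ R) L := by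
  induction R using Finset.induction_on with
  | empty => simpa using h𝒯.exists_star_tour o _ subset_rfl
  | insert t R htR ih =>
    obtain ⟨L, hL, hco⟩ := ih fun s hs => hR (Finset.mem_insert_of_mem hs)
    obtain ⟨ht𝒯, hot⟩ := Finset.mem_filter.1 (hR (Finset.mem_insert_self _ _))
    obtain ⟨x, y, z, P, A, B, C, rfl, rfl, hxy, hxz, hyz⟩ :=
      List.exists_split_three (h𝒯.card_eq t ht𝒯) fun x _ => h𝒯.mem_tour hL x
    have := hL.insert_coherent (by grind) hxy hxz hyz (by simp [hot, htR])
    rw [Finset.union_insert]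
    exact ⟨_, this.1, this.2 hco⟩

theorem IsTripleSystem.exists_coherent_tour {𝒯 : Finset (Finset V)} (h𝒯 : IsTripleSystem 𝒯)
    (o : V) : ∃ L, IsTour o 𝒯 L ∧ IsCoherent 𝒯 L := by
  have := h𝒯.exists_partial_tour o _ subset_rfl
  rwa [Finset.filter_union_filter_not_eq] at this

/-- A triple off the base point, added last and incoherently, obstructs orientability. -/
theorem IsTripleSystem.exists_incoherent_tour {𝒯 : Finset (Finset V)} (h𝒯 : IsTripleSystem 𝒯)
    {o : V} {t : Finset V} (ht : t ∈ 𝒯) (hot : o ∉ t) :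
    ∃ L, IsTour o 𝒯 L ∧ ∃ x y z, {x, y, z} ∈ 𝒯 ∧ x ≠ y ∧ x ≠ z ∧ y ≠ z ∧
      [x, y] <:+: L ∧ [x, z] <:+: L := by
  have htf : t ∈ 𝒯.filter (o ∉ ·) := Finset.mem_filter.2 ⟨ht, hot⟩
  obtain ⟨L, hL, -⟩ := h𝒯.exists_partial_tour o ((𝒯.filter (o ∉ ·)).erase t)
    (Finset.erase_subset _ _)
  obtain ⟨x, y, z, P, A, B, C, rfl, rfl, hxy, hxz, hyz⟩ :=
    List.exists_split_three (h𝒯.card_eq t ht) fun x _ => h𝒯.mem_tour hL x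
  have := hL.insert_incoherent (by grind) hxy hxz hyz (by simp [hot])
  rw [← Finset.union_insert, Finset.insert_erase htf, Finset.filter_union_filter_not_eq] at this
  exact ⟨_, this, x, y, z, ht, hxy, hxz, hyz,
    ⟨P, A.reverse ++ x :: z :: (B.reverse ++ y :: z :: C), by simp⟩,
    ⟨P ++ x :: y :: A.reverse, B.reverse ++ y :: z :: C, by simp⟩⟩

end Existence

/-! ### Circuits bounding a single complementary cell -/

theorem val_finRotate {m : ℕ} (i : Fin m) :
    (finRotate m i : ℕ) = if (i : ℕ) + 1 = m then 0 else (i : ℕ) + 1 := by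
  cases m with
  | zero => exact i.elim0
  | succ m => rw [coe_finRotate]; simp [Fin.ext_iff]

namespace AbstractSimplicialComplex

variable {V : Type*} [DecidableEq V]

/-- The closed walk `w` contains a step from `a` to `b`. -/
def IsDart {V : Type*} {m : ℕ} (w : Fin m → V) (a b : V) : Prop :=
  ∃ i, w i = a ∧ w (finRotate m i) = b

/-- The Eulerian circuit `w` bounds a single polygonal cell complementary to `T`, such that `T`
and the cell together form a closed surface: in the link of `v`, where two points are adjacent if
they form a triangle of `T` with `v`, or if `w` passes from one through `v` to the other, any two
points other than `v` are connected. -/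
structure IsCellBoundary (T : AbstractSimplicialComplex V) {m : ℕ} (w : Fin m → V) : Prop where
  eulerian : IsEulerianCircuit w
  link : ∀ v a b, a ≠ v → b ≠ v → Relation.EqvGen (fun a b => T.IsTriangle v a b ∨
    ∃ i, w i = a ∧ w (finRotate m i) = v ∧ w (finRotate m (finRotate m i)) = b) a b

open Classical in
/-- The triangles of `T`. -/
noncomputable def triples {V : Type*} [Fintype V] (T : AbstractSimplicialComplex V) :
    Finset (Finset V) :=
  {t | t ∈ T ∧ t.card = 3}

theorem mem_triples {V : Type*} [Fintype V] {T : AbstractSimplicialComplex V} {t : Finset V} :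
    t ∈ T.triples ↔ t ∈ T ∧ t.card = 3 := by
  simp [triples]

theorem IsSteinerTripleSystem.isTripleSystem [Fintype V] {T : AbstractSimplicialComplex V}
    (hT : T.IsSteinerTripleSystem) : IsTripleSystem T.triples where
  card_eq t ht := (mem_triples.1 ht).2
  exists_mem x y hxy := by
    obtain ⟨t, ⟨ht, ht3, hs⟩, -⟩ := hT.unique _ (hT.complete x y) (Finset.card_pair hxy)
    exact ⟨t, mem_triples.2 ⟨ht, ht3⟩, hs (by simp), hs (by simp)⟩
  unique s hs t ht x y hxy hxs hys hxt hyt := by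
    rw [mem_triples] at hs ht
    exact (hT.unique _ (hT.complete x y) (Finset.card_pair hxy)).unique
      ⟨hs.1, hs.2, by grind⟩ ⟨ht.1, ht.2, by grind⟩

theorem IsSteinerTripleSystem.card_triples [Fintype V] {T : AbstractSimplicialComplex V}
    (hT : T.IsSteinerTripleSystem) : 3 * T.triples.card = (Fintype.card V).choose 2 := by
  have h := hT.isTripleSystem
  have := Finset.sum_card_bipartiteAbove_eq_sum_card_bipartiteBelow (s := T.triples)
    (t := (Finset.univ : Finset V).powersetCard 2) (fun t e => e ⊆ t)
  rw [Finset.sum_const_nat (m := 3), Finset.sum_const_nat (m := 1)] at this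
  · rw [mul_comm, this, mul_one, Finset.card_powersetCard, Finset.card_univ]
  · intro e he
    obtain ⟨x, y, hxy, rfl⟩ := Finset.card_eq_two.1 (Finset.mem_powersetCard.1 he).2
    obtain ⟨t, ht, hxt, hyt⟩ := h.exists_mem x y hxy
    refine Finset.card_eq_one.2 ⟨t, ?_⟩
    ext s
    simp only [Finset.bipartiteBelow, Finset.mem_filter, Finset.mem_singleton]
    refine ⟨fun ⟨hs, hss⟩ => h.unique s hs t ht x y hxy (hss (by simp)) (hss (by simp)) hxt hyt, ?_⟩
    rintro rfl
    exact ⟨ht, by grind⟩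
  · intro t ht
    have : Finset.bipartiteAbove (fun t e => e ⊆ t) ((Finset.univ : Finset V).powersetCard 2) t
        = t.powersetCard 2 := by
      ext e
      simp [Finset.bipartiteAbove, Finset.mem_powersetCard, and_comm]
    rw [this, Finset.card_powersetCard, h.card_eq t ht]
    rfl

/-- A tour of all triangles, closed up cyclically. It traverses `n.choose 2` edges and every edge at
least once, hence exactly once. -/
theorem exists_circuit_of_isTour [Fintype V] {T : AbstractSimplicialComplex V}
    (hT : T.IsSteinerTripleSystem) {m : ℕ} (hm : m = (Fintype.card V).choose 2) {o : V} {L : List V}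
    (hL : IsTour o T.triples L) :
    ∃ w : Fin m → V, T.IsCellBoundary w ∧ ∀ a b, [a, b] <:+: L → IsDart w a b := by
  have h𝒯 := hT.isTripleSystem
  have hlen : L.length = m + 1 := by rw [hL.length, hT.card_triples, hm]
  let g : ℕ → V := fun k => L.getD k o
  have g0 : g 0 = o := by
    have := hL.head
    cases hM : L <;> simp_all [g]
  have gm : g m = o := by
    have := hL.last
    rw [List.getLast?_eq_getElem?, hlen] at this
    simp only [g, List.getD_eq_getElem?_getD]
    rw [Nat.add_sub_cancel] at this
    simp [this]
  let w : Fin m → V := fun i => g i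
  have wrot : ∀ i, w (finRotate m i) = g (i + 1) := by
    intro i
    simp only [w, val_finRotate]
    split_ifs with h
    · rw [h, gm, g0]
    · rfl
  have hdart : ∀ a b, [a, b] <:+: L → IsDart w a b := by
    rintro a b ⟨P, Q, rfl⟩
    simp only [List.length_append, List.length_cons, List.length_nil] at hlen
    refine ⟨⟨P.length, by omega⟩, ?_, ?_⟩
    · simp [w, g]
    · rw [wrot]
      simp [g]
  have hwin : ∀ a v b, [a, v, b] <:+: L →
      ∃ i, w i = a ∧ w (finRotate m i) = v ∧ w (finRotate m (finRotate m i)) = b := by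
    rintro a v b ⟨P, Q, rfl⟩
    simp only [List.length_append, List.length_cons, List.length_nil] at hlen
    refine ⟨⟨P.length, by omega⟩, ?_, ?_, ?_⟩
    · simp [w, g]
    · rw [wrot]
      simp [g]
    · rw [wrot, val_finRotate, if_neg (by simp; omega)]
      simp [g, add_assoc]
  have hne : ∀ i, w i ≠ w (finRotate m i) := by
    intro i
    have := (List.isChain_iff_getElem.1 hL.chain i (by omega)).1
    rw [wrot]
    simpa [w, g, List.getD_eq_getElem, hlen, i.2, Nat.lt_succ_of_lt i.2] using this
  have htrav : ∀ a b, a ≠ b → IsDart w a b ∨ IsDart w b a := by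
    intro a b hab
    obtain ⟨t, ht, hat, hbt⟩ := h𝒯.exists_mem a b hab
    exact (hL.traverses t ht a hat b hbt hab).imp (hdart _ _) (hdart _ _)
  refine ⟨w, ⟨?_, ?_⟩, hdart⟩
  · let f : Fin m → {e : Sym2 V // ¬ e.IsDiag} := fun i =>
      ⟨s(w i, w (finRotate m i)), by simpa using hne i⟩
    have hf : Function.Surjective f := by
      rintro ⟨e, he⟩
      induction e using Sym2.ind with
      | _ a b =>
        rcases htrav a b (by simpa using he) with ⟨i, hi, hi'⟩ | ⟨i, hi, hi'⟩
        · exact ⟨i, by simp [f, hi, hi', -finRotate_apply]⟩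
        · exact ⟨i, by simp [f, hi, hi', -finRotate_apply, Sym2.eq_swap]⟩
    have hb : Function.Bijective f := by
      rw [Fintype.bijective_iff_surjective_and_card]
      refine ⟨hf, ?_⟩
      rw [Sym2.card_subtype_not_diag, Fintype.card_fin, hm]
    refine ⟨fun i _ => (f i).2, fun i _ j _ hij => hb.1 (Subtype.ext hij), fun e he => ?_⟩
    obtain ⟨i, hi⟩ := hb.2 ⟨e, he⟩
    exact ⟨i, trivial, congrArg Subtype.val hi⟩
  · intro v a b ha hb
    obtain ⟨s, hs, hvs, has⟩ := h𝒯.exists_mem v a ha.symm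
    obtain ⟨t, ht, hvt, hbt⟩ := h𝒯.exists_mem v b hb.symm
    refine (hL.link v a b ha hb ⟨s, hs, hvs, has⟩ ⟨t, ht, hvt, hbt⟩).mono ?_
    rintro c d (h | h)
    · left
      obtain ⟨h, h3⟩ := mem_triples.1 h
      obtain ⟨hvc, hvd, hcd⟩ := Finset.card_triple_eq_three_iff.1 h3
      exact ⟨hvc, hvd, hcd, h⟩
    · exact Or.inr (hwin _ _ _ h)

theorem IsDart.ne {V : Type*} {m : ℕ} {w : Fin m → V} (hw : IsEulerianCircuit w) {a b : V}
    (h : IsDart w a b) : a ≠ b := by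
  obtain ⟨i, rfl, rfl⟩ := h
  simpa [-finRotate_apply] using hw.mapsTo (Set.mem_univ i)

theorem IsDart.not_symm {V : Type*} {m : ℕ} {w : Fin m → V} (hw : IsEulerianCircuit w) {a b : V}
    (h : IsDart w a b) : ¬ IsDart w b a := by
  rintro ⟨j, hj, hj'⟩
  have hab := h.ne hw
  obtain ⟨i, hi, hi'⟩ := h
  have : i = j := hw.injOn (Set.mem_univ _) (Set.mem_univ _)
    (by simp [hi, hi', hj, hj', -finRotate_apply])
  exact hab (by rw [← hi, this, hj])

theorem IsSteinerTripleSystem.exists_coherent_circuit [Fintype V] [Nonempty V]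
    {T : AbstractSimplicialComplex V} (hT : T.IsSteinerTripleSystem) {m : ℕ}
    (hm : m = (Fintype.card V).choose 2) :
    ∃ w : Fin m → V, T.IsCellBoundary w ∧
      ∀ a b c, T.IsTriangle a b c → IsDart w a b → IsDart w b c := by
  obtain ⟨L, hL, hco⟩ := hT.isTripleSystem.exists_coherent_tour (Classical.arbitrary V)
  obtain ⟨w, hw, hd⟩ := exists_circuit_of_isTour hT hm hL
  refine ⟨w, hw, ?_⟩
  rintro a b c ⟨hab, hac, hbc, ht⟩ hdab
  obtain ⟨x, y, z, h, hxy, hyz, hzx⟩ := hco {a, b, c}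
    (mem_triples.2 ⟨ht, Finset.card_eq_three.2 ⟨a, b, c, hab, hac, hbc, rfl⟩⟩)
  have hdba := hdab.not_symm hw.eulerian
  have hxy := hd _ _ hxy
  have hyz := hd _ _ hyz
  have hzx := hd _ _ hzx
  have := hxy.ne hw.eulerian
  have := hyz.ne hw.eulerian
  have := hzx.ne hw.eulerian
  have ha : a ∈ ({x, y, z} : Finset V) := by simp [← h]
  have hb : b ∈ ({x, y, z} : Finset V) := by simp [← h]
  have hc : c ∈ ({x, y, z} : Finset V) := by simp [← h]
  simp only [Finset.mem_insert, Finset.mem_singleton] at ha hb hc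
  rcases ha with rfl | rfl | rfl <;> rcases hb with rfl | rfl | rfl <;>
    rcases hc with rfl | rfl | rfl <;> tauto

theorem IsSteinerTripleSystem.exists_incoherent_circuit [Fintype V]
    {T : AbstractSimplicialComplex V}
    (hT : T.IsSteinerTripleSystem) {m : ℕ} (hm : m = (Fintype.card V).choose 2)
    (hV : 3 < Fintype.card V) :
    ∃ w : Fin m → V, T.IsCellBoundary w ∧
      ∃ a b c, T.IsTriangle a b c ∧ IsDart w a b ∧ IsDart w a c := by
  have h := hT.isTripleSystem
  obtain ⟨x, y, hxy⟩ := Fintype.exists_pair_of_one_lt_card (by omega : 1 < Fintype.card V)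
  obtain ⟨t, ht, -, -⟩ := h.exists_mem x y hxy
  obtain ⟨o, -, hot⟩ := Finset.exists_mem_notMem_of_card_lt_card
    (show t.card < (Finset.univ : Finset V).card by rw [h.card_eq t ht, Finset.card_univ]; exact hV)
  obtain ⟨L, hL, a, b, c, habc, hab, hac, hbc, h1, h2⟩ := h.exists_incoherent_tour ht hot
  obtain ⟨w, hw, hd⟩ := exists_circuit_of_isTour hT hm hL
  exact ⟨w, hw, a, b, c, ⟨hab, hac, hbc, (mem_triples.1 habc).1⟩, hd _ _ h1, hd _ _ h2⟩

end AbstractSimplicialComplex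

/-! ### Closed surfaces given by their triangles -/

namespace AbstractSimplicialComplex

/-- The complex whose faces are the nonempty subsets of the members of `𝒟`. -/
def ofFacets {V : Type*} (𝒟 : Finset (Finset V)) (h𝒟 : ∀ v, ∃ t ∈ 𝒟, v ∈ t) :
    AbstractSimplicialComplex V where
  faces := {s | s.Nonempty ∧ ∃ t ∈ 𝒟, s ⊆ t}
  isRelLowerSet_faces := by
    rintro s ⟨hs, t, ht, hst⟩
    exact ⟨hs, fun u hus hu => ⟨hu, t, ht, hus.trans hst⟩⟩
  singleton_mem v := by
    obtain ⟨t, ht, hv⟩ := h𝒟 v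
    exact ⟨Finset.singleton_nonempty v, t, ht, by simpa using hv⟩

theorem mem_ofFacets {V : Type*} {𝒟 : Finset (Finset V)} {h𝒟 : ∀ v, ∃ t ∈ 𝒟, v ∈ t}
    {s : Finset V} : s ∈ ofFacets 𝒟 h𝒟 ↔ s.Nonempty ∧ ∃ t ∈ 𝒟, s ⊆ t := Iff.rfl

theorem mem_ofFacets_iff_of_card_eq {V : Type*} {𝒟 : Finset (Finset V)}
    {h𝒟 : ∀ v, ∃ t ∈ 𝒟, v ∈ t} {d : ℕ} (hd : ∀ t ∈ 𝒟, t.card = d + 1) {s : Finset V} :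
    s ∈ ofFacets 𝒟 h𝒟 ∧ s.card = d + 1 ↔ s ∈ 𝒟 := by
  rw [mem_ofFacets]
  constructor
  · rintro ⟨⟨-, t, ht, hst⟩, hs⟩
    rwa [Finset.eq_of_subset_of_card_le hst (by rw [hs, hd t ht])]
  · intro hs
    exact ⟨⟨Finset.card_pos.1 (by rw [hd s hs]; omega), s, hs, subset_rfl⟩, hd s hs⟩

theorem isPure_ofFacets {V : Type*} {𝒟 : Finset (Finset V)}
    {h𝒟 : ∀ v, ∃ t ∈ 𝒟, v ∈ t} {d : ℕ} (hd : ∀ t ∈ 𝒟, t.card = d + 1) :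
    (ofFacets 𝒟 h𝒟).IsPure d := by
  rintro s ⟨-, t, ht, hst⟩
  have := (mem_ofFacets_iff_of_card_eq (h𝒟 := h𝒟) hd).2 ht
  exact ⟨(Finset.card_le_card hst).trans_eq (hd t ht), t, this.1, hst, this.2⟩

section

variable {V : Type*} [DecidableEq V] {K : AbstractSimplicialComplex V}

theorem mem_of_subset {V : Type*} {K : AbstractSimplicialComplex V} {s t : Finset V} (ht : t ∈ K)
    (hst : s ⊆ t) (hs : s.Nonempty) : s ∈ K :=
  (K.isRelLowerSet_faces ht).2 hst hs

theorem isTriangle_iff {a b c : V} :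
    K.IsTriangle a b c ↔ ({a, b, c} : Finset V) ∈ K ∧ ({a, b, c} : Finset V).card = 3 := by
  rw [Finset.card_triple_eq_three_iff, IsTriangle]
  tauto

theorem IsTriangle.swap {a b c : V} (h : K.IsTriangle a b c) : K.IsTriangle b a c :=
  ⟨h.1.symm, h.2.2.1, h.2.1, by rw [Finset.insert_comm]; exact h.2.2.2⟩

theorem IsTriangle.swap' {a b c : V} (h : K.IsTriangle a b c) : K.IsTriangle a c b :=
  ⟨h.2.1, h.1, h.2.2.1.symm, by rw [Finset.pair_comm]; exact h.2.2.2⟩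

theorem IsTriangle.adj {a b c : V} (h : K.IsTriangle a b c) : K.oneSkeleton.Adj a b :=
  ⟨h.1, mem_of_subset h.2.2.2 (by grind) (by simp)⟩

theorem IsPure.exists_isTriangle (hK : K.IsPure 2) {a b : V} (h : K.oneSkeleton.Adj a b) :
    ∃ c, K.IsTriangle a b c := by
  obtain ⟨-, u, hu, hsub, hcard⟩ := hK _ h.2
  obtain ⟨x, hx, hxs⟩ := Finset.exists_mem_notMem_of_card_lt_card
    (show ({a, b} : Finset V).card < u.card by rw [Finset.card_pair h.1]; omega)
  have h3 : ({a, b, x} : Finset V).card = 3 := by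
    rw [Finset.card_triple_eq_three_iff]
    have := h.1
    grind
  have : ({a, b, x} : Finset V) = u := Finset.eq_of_subset_of_card_le (by grind) (by omega)
  exact ⟨x, isTriangle_iff.2 ⟨this ▸ hu, h3⟩⟩

/-- The pair `a b` is a side of exactly two triangles. -/
def HasTwoTriangles (K : AbstractSimplicialComplex V) (a b : V) : Prop :=
  ∃ c d, c ≠ d ∧ ∀ x, K.IsTriangle a b x ↔ x = c ∨ x = d

theorem HasTwoTriangles.symm {a b : V} (h : K.HasTwoTriangles a b) : K.HasTwoTriangles b a := by
  obtain ⟨c, d, hcd, h⟩ := h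
  exact ⟨c, d, hcd, fun x => ⟨fun hx => (h x).1 hx.swap, fun hx => ((h x).2 hx).swap⟩⟩

/-- A criterion for closed surfaces in which the links appear only through the equivalence relations
generated by their edges. -/
theorem isClosedSurface_of_hasTwoTriangles [Finite V] (hK : K.IsPure 2)
    (hconn : K.oneSkeleton.Connected)
    (hlink : ∀ v a b, K.oneSkeleton.Adj v a → K.oneSkeleton.Adj v b →
      Relation.EqvGen (K.IsTriangle v) a b)
    (hdeg : ∀ a b, K.oneSkeleton.Adj a b → K.HasTwoTriangles a b) : K.IsClosedSurface where
  finite := inferInstance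
  pure := hK
  connected := hconn
  link_connected v := by
    have key : ∀ a b, Relation.EqvGen (K.IsTriangle v) a b → a = b ∨
        ∃ (ha : a ∈ K.oneSkeleton.neighborSet v) (hb : b ∈ K.oneSkeleton.neighborSet v),
          (K.linkGraph v).Reachable ⟨a, ha⟩ ⟨b, hb⟩ := by
      intro a b h
      induction h with
      | rel a b h =>
        exact Or.inr ⟨h.adj, h.swap'.adj, SimpleGraph.Adj.reachable (G := K.linkGraph v) h⟩
      | refl a => exact Or.inl rfl
      | symm a b _ ih =>
        rcases ih with rfl | ⟨ha, hb, h⟩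
        · exact Or.inl rfl
        · exact Or.inr ⟨hb, ha, h.symm⟩
      | trans a b c _ _ ih1 ih2 =>
        rcases ih1 with rfl | ⟨ha, hb, h⟩
        · exact ih2
        · rcases ih2 with rfl | ⟨hb', hc, h'⟩
          · exact Or.inr ⟨ha, hb, h⟩
          · exact Or.inr ⟨ha, hc, h.trans h'⟩
    have hne : Nonempty (K.oneSkeleton.neighborSet v) := by
      obtain ⟨-, u, hu, hsub, hcard⟩ := hK _ (K.singleton_mem v)
      obtain ⟨x, hx, hxv⟩ := Finset.exists_mem_ne (by omega : 1 < u.card) v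
      exact ⟨x, hxv.symm, mem_of_subset hu (by grind) (by simp)⟩
    refine (SimpleGraph.connected_iff _).2 ⟨?_, hne⟩
    rintro ⟨a, ha⟩ ⟨b, hb⟩
    rcases key a b (hlink v a b ha hb) with rfl | ⟨_, _, h⟩
    · exact .refl _
    · exact h
  link_degree := by
    rintro v ⟨a, ha⟩
    obtain ⟨c, d, hcd, h⟩ := hdeg v a ha
    have hc := (h c).2 (Or.inl rfl)
    have hd := (h d).2 (Or.inr rfl)
    refine Set.ncard_eq_two.2 ⟨⟨c, hc.swap'.adj⟩, ⟨d, hd.swap'.adj⟩,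
      fun h => hcd (congrArg Subtype.val h), ?_⟩
    ext ⟨x, hx⟩
    rw [Set.mem_insert_iff, Set.mem_singleton_iff, Subtype.ext_iff, Subtype.ext_iff]
    exact h x

end

/-! ### Face numbers and chromatic numbers -/

section Counting

variable {V : Type*} {K : AbstractSimplicialComplex V}

theorem faceNumber_zero_eq (K : AbstractSimplicialComplex V) : K.faceNumber 0 = Nat.card V := by
  have : {t : Finset V | t ∈ K ∧ t.card = 0 + 1} = Set.range (fun v : V => ({v} : Finset V)) := by
    ext t
    simp only [Set.mem_ofPred_eq, zero_add, Finset.card_eq_one, Set.mem_range]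
    constructor
    · rintro ⟨-, a, rfl⟩
      exact ⟨a, rfl⟩
    · rintro ⟨a, rfl⟩
      exact ⟨K.singleton_mem a, a, rfl⟩
  rw [faceNumber, this, ← Set.image_univ, Set.ncard_image_of_injective _ Finset.singleton_injective,
    Set.ncard_univ]

theorem IsPure.faceNumber_eq_zero {d : ℕ} (hK : K.IsPure d) {i : ℕ} (hi : d < i) :
    K.faceNumber i = 0 := by
  have : {t : Finset V | t ∈ K ∧ t.card = i + 1} = ∅ := by
    ext t
    simp only [Set.mem_ofPred_eq, Set.mem_empty_iff_false, iff_false, not_and]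
    intro ht h
    have := (hK t ht).1
    omega
  rw [faceNumber, this, Set.ncard_empty]

theorem IsPure.eulerChar_eq (hK : K.IsPure 2) (hV : 3 ≤ Nat.card V) :
    K.eulerChar = K.faceNumber 0 - K.faceNumber 1 + K.faceNumber 2 := by
  have : ∑ i ∈ Finset.range 3, (-1) ^ i * (K.faceNumber i : ℤ) = K.eulerChar := by
    refine Finset.sum_subset (by simpa using hV) fun i _ hi => ?_
    rw [hK.faceNumber_eq_zero (by rw [Finset.mem_range] at hi; omega)]
    simp
  rw [← this]
  simp [Finset.sum_range_succ]
  ring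

/-- Double counting of the incidences of edges and triangles. -/
theorem two_mul_faceNumber_one [Fintype V] [DecidableEq V]
    (hdeg : ∀ a b, K.oneSkeleton.Adj a b → K.HasTwoTriangles a b) :
    2 * K.faceNumber 1 = 3 * K.faceNumber 2 := by
  classical
  let E : Finset (Finset V) := {t | t ∈ K ∧ t.card = 2}
  let F : Finset (Finset V) := {t | t ∈ K ∧ t.card = 3}
  have hE : K.faceNumber 1 = E.card := by
    rw [faceNumber, ← Set.ncard_coe_finset]
    simp [E]
  have hF : K.faceNumber 2 = F.card := by
    rw [faceNumber, ← Set.ncard_coe_finset]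
    simp [F]
  have := Finset.sum_card_bipartiteAbove_eq_sum_card_bipartiteBelow (s := E) (t := F)
    (fun e t => e ⊆ t)
  rw [Finset.sum_const_nat (m := 2), Finset.sum_const_nat (m := 3)] at this
  · rw [hE, hF]
    linarith
  · intro t ht
    obtain ⟨htK, ht3⟩ := (Finset.mem_filter.1 ht).2
    have : Finset.bipartiteBelow (fun e t => e ⊆ t) E t = t.powersetCard 2 := by
      ext e
      simp only [Finset.bipartiteBelow, Finset.mem_filter, Finset.mem_powersetCard, E,
        Finset.mem_univ, true_and]
      refine ⟨fun h => ⟨h.2, h.1.2⟩, fun h => ⟨⟨mem_of_subset htK h.1 ?_, h.2⟩, h.1⟩⟩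
      exact Finset.card_pos.1 (by omega)
    rw [this, Finset.card_powersetCard, ht3]
    rfl
  · intro e he
    obtain ⟨heK, he2⟩ := (Finset.mem_filter.1 he).2
    obtain ⟨a, b, hab, rfl⟩ := Finset.card_eq_two.1 he2
    obtain ⟨c, d, hcd, h⟩ := hdeg a b ⟨hab, heK⟩
    have hc := (h c).2 (Or.inl rfl)
    have hd := (h d).2 (Or.inr rfl)
    refine Finset.card_eq_two.2 ⟨{a, b, c}, {a, b, d}, ?_, ?_⟩
    · intro heq
      have : c ∈ ({a, b, d} : Finset V) := by simp [← heq]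
      have := hc.2.1
      have := hc.2.2.1
      grind
    · ext t
      simp only [Finset.bipartiteAbove, Finset.mem_filter, F, Finset.mem_univ, true_and,
        Finset.mem_insert, Finset.mem_singleton]
      constructor
      · rintro ⟨⟨htK, ht3⟩, hst⟩
        obtain ⟨x, hx, hxs⟩ := Finset.exists_mem_notMem_of_card_lt_card
          (show ({a, b} : Finset V).card < t.card by omega)
        have h3 : ({a, b, x} : Finset V).card = 3 := by
          rw [Finset.card_triple_eq_three_iff]
          grind
        have heq : ({a, b, x} : Finset V) = t :=
          Finset.eq_of_subset_of_card_le (by grind) (by omega)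
        rcases (h x).1 (isTriangle_iff.2 ⟨heq ▸ htK, h3⟩) with rfl | rfl
        · exact Or.inl heq.symm
        · exact Or.inr heq.symm
      · rintro (rfl | rfl)
        · exact ⟨isTriangle_iff.1 hc, by grind⟩
        · exact ⟨isTriangle_iff.1 hd, by grind⟩

end Counting

theorem chromaticNumber_le_of_map_mem {V W : Type*} {K : AbstractSimplicialComplex V}
    {L : AbstractSimplicialComplex W} (f : V ↪ W) (hf : ∀ t ∈ K, t.map f ∈ L) (s : ℕ) :
    K.chromaticNumber s ≤ L.chromaticNumber s := by
  refine biInf_mono ?_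
  rintro k ⟨c, hc⟩
  refine ⟨c ∘ f, fun t ht hcard ⟨a, ha⟩ => hc _ (hf t ht) (by simpa using hcard) ⟨a, ?_⟩⟩
  simpa using ha

end AbstractSimplicialComplex

namespace AbstractSimplicialComplex

/-! ### Fan triangulation of a polygon -/

section Fan

/-- The triangulation of the `m`-gon by the triangles `0, i, i + 1` with `0 < i < m - 1`. -/
def fan (m : ℕ) [NeZero m] : Finset (Finset (Fin m)) :=
  ({i : Fin m | (i : ℕ) ≠ 0 ∧ (i : ℕ) + 1 ≠ m} : Finset (Fin m)).image
    fun i => {0, i, finRotate m i}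

variable {m : ℕ} [NeZero m]

theorem mem_fan {t : Finset (Fin m)} : t ∈ fan m ↔
    ∃ i j : Fin m, (i : ℕ) ≠ 0 ∧ (j : ℕ) = i + 1 ∧ t = {0, i, j} := by
  simp only [fan, Finset.mem_image, Finset.mem_filter, Finset.mem_univ, true_and]
  constructor
  · rintro ⟨i, ⟨h0, h1⟩, rfl⟩
    exact ⟨i, _, h0, by rw [val_finRotate, if_neg h1], rfl⟩
  · rintro ⟨i, j, h0, h1, rfl⟩
    have := j.2
    refine ⟨i, ⟨h0, by omega⟩, ?_⟩
    have : finRotate m i = j := by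
      ext
      rw [val_finRotate, if_neg (by omega), h1]
    rw [this]

/-- Membership in the fan for unordered triples of vertices: one of them is `0`, and the two others
are consecutive. -/
theorem mem_fan_iff {i j k : Fin m} :
    ({i, j, k} ∈ fan m ∧ ({i, j, k} : Finset (Fin m)).card = 3) ↔
      ((i : ℕ) = 0 ∧ (j : ℕ) ≠ 0 ∧ (k : ℕ) ≠ 0 ∧ ((j : ℕ) = k + 1 ∨ (k : ℕ) = j + 1)) ∨
      ((j : ℕ) = 0 ∧ (i : ℕ) ≠ 0 ∧ (k : ℕ) ≠ 0 ∧ ((i : ℕ) = k + 1 ∨ (k : ℕ) = i + 1)) ∨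
      ((k : ℕ) = 0 ∧ (i : ℕ) ≠ 0 ∧ (j : ℕ) ≠ 0 ∧ ((i : ℕ) = j + 1 ∨ (j : ℕ) = i + 1)) := by
  rw [mem_fan, Finset.card_triple_eq_three_iff]
  constructor
  · rintro ⟨⟨a, b, ha, hb, h⟩, hij, hik, hjk⟩
    have hi : i ∈ ({0, a, b} : Finset (Fin m)) := by simp [← h]
    have hj : j ∈ ({0, a, b} : Finset (Fin m)) := by simp [← h]
    have hk : k ∈ ({0, a, b} : Finset (Fin m)) := by simp [← h]
    simp only [Finset.mem_insert, Finset.mem_singleton, Fin.ext_iff, Fin.val_zero] at hi hj hk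
    rw [Ne, Fin.ext_iff] at hij hik hjk
    omega
  · have z : ∀ x : Fin m, (x : ℕ) = 0 → x = 0 := fun x hx => by ext; simpa using hx
    rintro h
    refine ⟨?_, ?_, ?_, ?_⟩
    · rcases h with ⟨h, h1, h2, h3 | h3⟩ | ⟨h, h1, h2, h3 | h3⟩ | ⟨h, h1, h2, h3 | h3⟩ <;>
        obtain rfl := z _ h
      exacts [⟨k, j, h2, h3, by grind⟩, ⟨j, k, h1, h3, by grind⟩, ⟨k, i, h2, h3, by grind⟩,
        ⟨i, k, h1, h3, by grind⟩, ⟨j, i, h2, h3, by grind⟩, ⟨i, j, h1, h3, by grind⟩]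
    all_goals
      rw [Ne, Fin.ext_iff]
      omega

theorem isPolygonTriangulation_fan (hm : 3 ≤ m) : IsPolygonTriangulation (fan m) where
  card_eq_three t ht := by
    obtain ⟨i, j, hi, hj, rfl⟩ := mem_fan.1 ht
    exact (mem_fan_iff.2 (Or.inl ⟨by simp, hi, by omega, Or.inr hj⟩)).2
  card_add_two := by
    rw [fan, Finset.card_image_of_injOn]
    · have : ({i : Fin m | (i : ℕ) ≠ 0 ∧ (i : ℕ) + 1 ≠ m} : Finset (Fin m)) =
          Finset.univ \ {⟨0, by omega⟩, ⟨m - 1, by omega⟩} := by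
        ext i
        simp only [Finset.mem_filter, Finset.mem_univ, true_and, Finset.mem_sdiff,
          Finset.mem_insert, Finset.mem_singleton, Fin.ext_iff]
        omega
      rw [this, Finset.card_sdiff_of_subset (Finset.subset_univ _), Finset.card_univ,
        Fintype.card_fin, Finset.card_pair (by rw [Ne, Fin.ext_iff]; simp; omega)]
      omega
    · intro i hi j hj h
      simp only [Finset.coe_filter, Finset.mem_univ, true_and, Set.mem_ofPred_eq] at hi hj
      dsimp only at h
      have h1 : i ∈ ({0, j, finRotate m j} : Finset (Fin m)) := by simp [← h, -finRotate_apply]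
      have h2 : j ∈ ({0, i, finRotate m i} : Finset (Fin m)) := by simp [h, -finRotate_apply]
      simp only [Finset.mem_insert, Finset.mem_singleton, Fin.ext_iff, Fin.val_zero, val_finRotate,
        if_neg hi.2, if_neg hj.2] at h1 h2
      ext
      omega
  noncrossing s hs t ht a ha c hc b hb d hd := by
    obtain ⟨i, j, hi, hj, rfl⟩ := mem_fan.1 hs
    obtain ⟨k, l, hk, hl, rfl⟩ := mem_fan.1 ht
    simp only [Finset.mem_insert, Finset.mem_singleton, Fin.ext_iff, Fin.val_zero] at ha hb hc hd
    simp only [Fin.lt_def]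
    omega

end Fan

/-! ### The zigzag completion -/

theorem _root_.Finset.pair_eq_pair_iff {α : Type*} [DecidableEq α] {x y z w : α} :
    ({x, y} : Finset α) = {z, w} ↔ x = z ∧ y = w ∨ x = w ∧ y = z := by
  rw [← Finset.coe_inj]
  simpa using Set.pair_eq_pair_iff

theorem finRotate_ne {m : ℕ} (hm : 3 ≤ m) (i : Fin m) : finRotate m i ≠ i := by
  rw [Ne, Fin.ext_iff, val_finRotate]
  split_ifs <;> omega

theorem finRotate_finRotate_ne {m : ℕ} (hm : 3 ≤ m) (i : Fin m) :
    finRotate m (finRotate m i) ≠ i := by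
  rw [Ne, Fin.ext_iff, val_finRotate, val_finRotate]
  split_ifs <;> omega

section Zigzag

variable {V : Type*} [DecidableEq V] [Fintype V] {m : ℕ} [NeZero m]

/-- The triangles of `T`, of the zigzag annulus along `w`, and of the fan in the inner polygon, each
written as the disjoint union of its old and its new vertices. -/
noncomputable def zigzagTriangles (T : AbstractSimplicialComplex V) (w : Fin m → V) :
    Finset (Finset (V ⊕ Fin m)) :=
  ((T.triples.image fun s => s.disjSum ∅) ∪
    Finset.univ.image fun i => ({w i, w (finRotate m i)} : Finset V).disjSum {i}) ∪
  ((Finset.univ.image fun i => ({w (finRotate m i)} : Finset V).disjSum {i, finRotate m i}) ∪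
    (fan m).image fun s => (∅ : Finset V).disjSum s)

variable {T : AbstractSimplicialComplex V} {w : Fin m → V}

theorem mem_zigzagTriangles {t : Finset (V ⊕ Fin m)} : t ∈ zigzagTriangles T w ↔
    (t.toLeft ∈ T.triples ∧ t.toRight = ∅) ∨
    (∃ i, t.toLeft = {w i, w (finRotate m i)} ∧ t.toRight = {i}) ∨
    (∃ i, t.toLeft = {w (finRotate m i)} ∧ t.toRight = {i, finRotate m i}) ∨
    (t.toLeft = ∅ ∧ t.toRight ∈ fan m) := by
  simp only [zigzagTriangles, Finset.mem_union, Finset.mem_image, Finset.mem_univ, true_and,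
    Finset.disjSum_eq_iff, or_assoc, existsAndEq, eq_comm (b := t.toLeft), eq_comm (b := t.toRight)]
  simp [and_comm, eq_comm]

theorem IsEulerianCircuit.ne {V : Type*} {m : ℕ} {w : Fin m → V} (hw : IsEulerianCircuit w)
    (i : Fin m) : w i ≠ w (finRotate m i) :=
  IsDart.ne hw ⟨i, rfl, rfl⟩

theorem card_of_mem_zigzagTriangles (hm : 3 ≤ m) (hw : IsEulerianCircuit w)
    {t : Finset (V ⊕ Fin m)} (ht : t ∈ zigzagTriangles T w) : t.card = 2 + 1 := by
  rw [← Finset.card_toLeft_add_card_toRight]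
  rcases mem_zigzagTriangles.1 ht with ⟨h1, h2⟩ | ⟨i, h1, h2⟩ | ⟨i, h1, h2⟩ | ⟨h1, h2⟩
  · rw [h2, (mem_triples.1 h1).2, Finset.card_empty]
  · rw [h1, h2, Finset.card_pair (hw.ne i), Finset.card_singleton]
  · rw [h1, h2, Finset.card_pair (finRotate_ne hm i).symm, Finset.card_singleton]
  · rw [h1, Finset.card_empty, (isPolygonTriangulation_fan hm).card_eq_three _ h2]

/-- The four families of triangles are disjoint, since they have `0`, `1`, `2` and `3` new
vertices. -/
theorem card_zigzagTriangles (hm : 3 ≤ m) :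
    (zigzagTriangles T w).card = T.triples.card + m + (m + (fan m).card) := by
  have hinj : ∀ {a b : Finset V} {c d : Finset (Fin m)}, a.disjSum c = b.disjSum d → c = d :=
    fun h => (Finset.disjSum_inj.1 h).2
  have hdisj : ∀ {A B : Finset (Finset (V ⊕ Fin m))} {k : ℕ}, (∀ t ∈ A, t.toRight.card < k) →
      (∀ t ∈ B, k ≤ t.toRight.card) → Disjoint A B := by
    intro A B k hA hB
    rw [Finset.disjoint_left]
    intro t htA htB
    exact absurd (hB t htB) (by simpa using hA t htA)
  have c2 : ∀ i, ({i, finRotate m i} : Finset (Fin m)).card = 2 := fun i =>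
    Finset.card_pair (finRotate_ne hm i).symm
  have c3 := (isPolygonTriangulation_fan hm).card_eq_three
  rw [zigzagTriangles, Finset.card_union_of_disjoint, Finset.card_union_of_disjoint,
    Finset.card_union_of_disjoint, Finset.card_image_of_injective, Finset.card_image_of_injective,
    Finset.card_image_of_injective, Finset.card_image_of_injective, Finset.card_univ,
    Fintype.card_fin]
  · intro s t h
    exact hinj h
  · intro i j h
    have h := hinj h
    have h1 : i ∈ ({j, finRotate m j} : Finset (Fin m)) := by simp [← h, -finRotate_apply]
    have h2 : j ∈ ({i, finRotate m i} : Finset (Fin m)) := by simp [h, -finRotate_apply]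
    rw [Finset.mem_insert, Finset.mem_singleton] at h1 h2
    rcases h1 with rfl | rfl
    · rfl
    · rcases h2 with h2 | h2
      · exact h2.symm
      · exact absurd h2.symm (finRotate_finRotate_ne hm j)
  · intro i j h
    simpa using hinj h
  · intro s t h
    exact (Finset.disjSum_inj.1 h).1
  · refine hdisj (k := 3) ?_ ?_
    · simp [-finRotate_apply, c2]
    · simpa [-Finset.empty_disjSum] using fun t ht => (c3 t ht).ge
  · exact hdisj (k := 1) (by simp [-Finset.disjSum_empty]) (by simp)
  · refine hdisj (k := 2) ?_ ?_
    · simp only [Finset.mem_union, Finset.mem_image]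
      rintro t (⟨s, -, rfl⟩ | ⟨s, -, rfl⟩) <;> simp [-Finset.disjSum_empty]
    · simp only [Finset.mem_union, Finset.mem_image]
      rintro t (⟨i, -, rfl⟩ | ⟨s, hs, rfl⟩)
      · rw [Finset.toRight_disjSum, c2]
      · rw [Finset.toRight_disjSum, c3 s hs]
        omega

/-- The completion of `T` by a zigzag annulus along `w` and a fan in the inner polygon. -/
noncomputable def zigzag (T : AbstractSimplicialComplex V) (w : Fin m → V)
    (hT : ∀ v, ∃ t ∈ T.triples, v ∈ t) : AbstractSimplicialComplex (V ⊕ Fin m) :=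
  ofFacets (zigzagTriangles T w) <| by
    rintro (v | i)
    · obtain ⟨t, ht, hv⟩ := hT v
      exact ⟨t.disjSum ∅, mem_zigzagTriangles.2
        (Or.inl (by simpa [-Finset.disjSum_empty] using ht)), by simpa using hv⟩
    · exact ⟨({w i, w (finRotate m i)} : Finset V).disjSum {i},
        mem_zigzagTriangles.2 (Or.inr (Or.inl ⟨i, by simp⟩)), by simp⟩

variable {hT : ∀ v, ∃ t ∈ T.triples, v ∈ t}

theorem isZigzagCompletion_zigzag (hm : 3 ≤ m) (hw : IsEulerianCircuit w) :
    IsZigzagCompletion T w (fan m) (zigzag T w hT) := by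
  intro t
  rw [zigzag, mem_ofFacets_iff_of_card_eq (d := 2) fun t ht => card_of_mem_zigzagTriangles hm hw ht,
    mem_zigzagTriangles]
  refine or_congr ?_ (or_congr (exists_congr fun i => ?_) (or_congr (exists_congr fun i => ?_) ?_))
  · simp only [← Finset.disjSum_empty, Finset.eq_disjSum_iff, mem_triples]
    constructor
    · rintro ⟨⟨h1, h2⟩, h3⟩
      exact ⟨_, h1, h2, rfl, h3⟩
    · rintro ⟨s, h1, h2, rfl, h3⟩
      exact ⟨⟨h1, h2⟩, h3⟩
  · rw [← Finset.eq_disjSum_iff]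
    convert Iff.rfl using 2
    rw [Finset.eq_disjSum_iff]
    constructor <;> ext <;> simp [-finRotate_apply]
  · rw [← Finset.eq_disjSum_iff]
    convert Iff.rfl using 2
    rw [Finset.eq_disjSum_iff]
    constructor <;> ext <;> simp [-finRotate_apply]
  · simp only [← Finset.empty_disjSum, Finset.eq_disjSum_iff]
    constructor
    · rintro ⟨h1, h2⟩
      exact ⟨_, h2, h1, rfl⟩
    · rintro ⟨s, h1, h2, rfl⟩
      exact ⟨h2, h1⟩

theorem zigzag_isTriangle_iff (hm : 3 ≤ m) (hw : IsEulerianCircuit w) {a b c : V ⊕ Fin m} :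
    (zigzag T w hT).IsTriangle a b c ↔ {a, b, c} ∈ zigzagTriangles T w := by
  rw [isTriangle_iff, zigzag, mem_ofFacets_iff_of_card_eq (d := 2)
    fun t ht => card_of_mem_zigzagTriangles hm hw ht]

theorem zigzag_isTriangle_lll (hm : 3 ≤ m) (hw : IsEulerianCircuit w) {a b c : V} :
    (zigzag T w hT).IsTriangle (.inl a) (.inl b) (.inl c) ↔ T.IsTriangle a b c := by
  rw [zigzag_isTriangle_iff hm hw, mem_zigzagTriangles, isTriangle_iff, ← mem_triples]
  have l : ({.inl a, .inl b, .inl c} : Finset (V ⊕ Fin m)).toLeft = {a, b, c} := by ext; simp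
  have r : ({.inl a, .inl b, .inl c} : Finset (V ⊕ Fin m)).toRight = ∅ := by ext; simp
  rw [l, r]
  refine ⟨?_, fun h => Or.inl ⟨h, rfl⟩⟩
  rintro (⟨h, -⟩ | ⟨i, -, h⟩ | ⟨i, -, h⟩ | ⟨h, -⟩)
  exacts [h, absurd h.symm (Finset.singleton_ne_empty _),
    absurd h.symm (Finset.insert_ne_empty _ _),
    absurd h (Finset.insert_ne_empty _ _)]

theorem zigzag_isTriangle_llr (hm : 3 ≤ m) (hw : IsEulerianCircuit w) {a b : V} {i : Fin m} :
    (zigzag T w hT).IsTriangle (.inl a) (.inl b) (.inr i) ↔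
      (a = w i ∧ b = w (finRotate m i)) ∨ (a = w (finRotate m i) ∧ b = w i) := by
  rw [zigzag_isTriangle_iff hm hw, mem_zigzagTriangles]
  have l : ({.inl a, .inl b, .inr i} : Finset (V ⊕ Fin m)).toLeft = {a, b} := by ext; simp
  have r : ({.inl a, .inl b, .inr i} : Finset (V ⊕ Fin m)).toRight = {i} := by ext; simp
  rw [l, r]
  constructor
  · rintro (⟨-, h⟩ | ⟨j, h1, h2⟩ | ⟨j, -, h⟩ | ⟨h, -⟩)
    · exact absurd h (Finset.singleton_ne_empty _)
    · obtain rfl := Finset.singleton_injective h2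
      exact Finset.pair_eq_pair_iff.1 h1
    · have := Finset.card_pair (finRotate_ne hm j).symm
      rw [← h, Finset.card_singleton] at this
      omega
    · exact absurd h (Finset.insert_ne_empty _ _)
  · rintro (⟨rfl, rfl⟩ | ⟨rfl, rfl⟩)
    · exact Or.inr (Or.inl ⟨i, rfl, rfl⟩)
    · exact Or.inr (Or.inl ⟨i, Finset.pair_comm _ _, rfl⟩)

theorem zigzag_isTriangle_lrr (hm : 3 ≤ m) (hw : IsEulerianCircuit w) {a : V} {i j : Fin m} :
    (zigzag T w hT).IsTriangle (.inl a) (.inr i) (.inr j) ↔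
      (j = finRotate m i ∧ a = w j) ∨ (i = finRotate m j ∧ a = w i) := by
  rw [zigzag_isTriangle_iff hm hw, mem_zigzagTriangles]
  have l : ({.inl a, .inr i, .inr j} : Finset (V ⊕ Fin m)).toLeft = {a} := by ext; simp
  have r : ({.inl a, .inr i, .inr j} : Finset (V ⊕ Fin m)).toRight = {i, j} := by ext; simp
  rw [l, r]
  constructor
  · rintro (⟨-, h⟩ | ⟨k, h, -⟩ | ⟨k, h1, h2⟩ | ⟨h, -⟩)
    · exact absurd h (Finset.insert_ne_empty _ _)
    · have := Finset.card_pair (hw.ne k)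
      rw [← h, Finset.card_singleton] at this
      omega
    · obtain rfl := Finset.singleton_injective h1
      rcases Finset.pair_eq_pair_iff.1 h2 with ⟨rfl, rfl⟩ | ⟨rfl, rfl⟩
      exacts [Or.inl ⟨rfl, rfl⟩, Or.inr ⟨rfl, rfl⟩]
    · exact absurd h (Finset.singleton_ne_empty _)
  · rintro (⟨rfl, rfl⟩ | ⟨rfl, rfl⟩)
    · exact Or.inr (Or.inr (Or.inl ⟨i, rfl, rfl⟩))
    · exact Or.inr (Or.inr (Or.inl ⟨j, rfl, Finset.pair_comm _ _⟩))

theorem zigzag_isTriangle_rrr (hm : 3 ≤ m) (hw : IsEulerianCircuit w) {i j k : Fin m} :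
    (zigzag T w hT).IsTriangle (.inr i) (.inr j) (.inr k) ↔
      ((i : ℕ) = 0 ∧ (j : ℕ) ≠ 0 ∧ (k : ℕ) ≠ 0 ∧ ((j : ℕ) = k + 1 ∨ (k : ℕ) = j + 1)) ∨
      ((j : ℕ) = 0 ∧ (i : ℕ) ≠ 0 ∧ (k : ℕ) ≠ 0 ∧ ((i : ℕ) = k + 1 ∨ (k : ℕ) = i + 1)) ∨
      ((k : ℕ) = 0 ∧ (i : ℕ) ≠ 0 ∧ (j : ℕ) ≠ 0 ∧ ((i : ℕ) = j + 1 ∨ (j : ℕ) = i + 1)) := by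
  rw [← mem_fan_iff, zigzag_isTriangle_iff hm hw, mem_zigzagTriangles]
  have l : ({.inr i, .inr j, .inr k} : Finset (V ⊕ Fin m)).toLeft = ∅ := by ext; simp
  have r : ({.inr i, .inr j, .inr k} : Finset (V ⊕ Fin m)).toRight = {i, j, k} := by ext; simp
  rw [l, r]
  have : {i, j, k} ∈ fan m → ({i, j, k} : Finset (Fin m)).card = 3 :=
    (isPolygonTriangulation_fan hm).card_eq_three _
  constructor
  · rintro (⟨-, h⟩ | ⟨i, h, -⟩ | ⟨i, h, -⟩ | ⟨-, h⟩)
    exacts [absurd h (Finset.insert_ne_empty _ _), absurd h.symm (Finset.insert_ne_empty _ _),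
      absurd h.symm (Finset.singleton_ne_empty _), ⟨h, this h⟩]
  · exact fun h => Or.inr (Or.inr (Or.inr ⟨rfl, h.1⟩))

end Zigzag

end AbstractSimplicialComplex

/-! ### The zigzag completion is a closed surface -/

theorem eq_finRotate_iff {m : ℕ} {i j : Fin m} : j = finRotate m i ↔
    ((i : ℕ) + 1 = m ∧ (j : ℕ) = 0) ∨ ((i : ℕ) + 1 ≠ m ∧ (j : ℕ) = i + 1) := by
  rw [Fin.ext_iff, val_finRotate]
  split_ifs with h <;> simp [h]

namespace AbstractSimplicialComplex

variable {V : Type*} [DecidableEq V]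

theorem IsSteinerTripleSystem.exists_third {T : AbstractSimplicialComplex V}
    (hT : T.IsSteinerTripleSystem) {a b : V} (hab : a ≠ b) :
    ∃ c, ∀ x, T.IsTriangle a b x ↔ x = c := by
  obtain ⟨c, hc⟩ := hT.pure.exists_isTriangle ⟨hab, hT.complete a b⟩
  refine ⟨c, fun x => ⟨fun hx => ?_, fun hx => hx ▸ hc⟩⟩
  have h1 := isTriangle_iff.1 hc
  have h2 := isTriangle_iff.1 hx
  have : ({a, b, c} : Finset V) = {a, b, x} :=
    (hT.unique _ (hT.complete a b) (Finset.card_pair hab)).unique ⟨h1.1, h1.2, by grind⟩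
      ⟨h2.1, h2.2, by grind⟩
  have hx' : x ∈ ({a, b, c} : Finset V) := by simp [this]
  have := hx.2.1
  have := hx.2.2.1
  grind

theorem IsSteinerTripleSystem.exists_mem_triples [Fintype V] [Nontrivial V]
    {T : AbstractSimplicialComplex V} (hT : T.IsSteinerTripleSystem) (v : V) :
    ∃ t ∈ T.triples, v ∈ t := by
  obtain ⟨u, hu⟩ := exists_ne v
  obtain ⟨t, ht, -, hv⟩ := hT.isTripleSystem.exists_mem u v hu
  exact ⟨t, ht, hv⟩

theorem IsEulerianCircuit.isDart_or {V : Type*} {m : ℕ} {w : Fin m → V} (hw : IsEulerianCircuit w)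
    {a b : V} (hab : a ≠ b) : IsDart w a b ∨ IsDart w b a := by
  obtain ⟨i, -, hi⟩ := hw.surjOn (show s(a, b) ∈ {e : Sym2 V | ¬ e.IsDiag} by simpa using hab)
  rcases Sym2.eq_iff.1 hi with ⟨h1, h2⟩ | ⟨h1, h2⟩
  exacts [Or.inl ⟨i, h1, h2⟩, Or.inr ⟨i, h1, h2⟩]

theorem IsEulerianCircuit.isDart_iff {V : Type*} {m : ℕ} {w : Fin m → V} (hw : IsEulerianCircuit w)
    {a b : V} (hab : a ≠ b) : IsDart w a b ↔ ¬ IsDart w b a :=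
  ⟨fun h => h.not_symm hw, fun h => (hw.isDart_or hab).resolve_right h⟩

section

variable [Fintype V] {m : ℕ} [NeZero m] {T : AbstractSimplicialComplex V} {w : Fin m → V}
  {hV : ∀ v, ∃ t ∈ T.triples, v ∈ t}

theorem zigzag_isTriangle_lrl (hm : 3 ≤ m) (hw : IsEulerianCircuit w) {a b : V} {i : Fin m} :
    (zigzag T w hV).IsTriangle (.inl a) (.inr i) (.inl b) ↔
      (a = w i ∧ b = w (finRotate m i)) ∨ (a = w (finRotate m i) ∧ b = w i) := by
  rw [← zigzag_isTriangle_llr (hT := hV) hm hw]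
  exact ⟨IsTriangle.swap', IsTriangle.swap'⟩

theorem zigzag_isTriangle_rrl (hm : 3 ≤ m) (hw : IsEulerianCircuit w) {a : V} {i j : Fin m} :
    (zigzag T w hV).IsTriangle (.inr i) (.inr j) (.inl a) ↔
      (j = finRotate m i ∧ a = w j) ∨ (i = finRotate m j ∧ a = w i) := by
  rw [← zigzag_isTriangle_lrr (hT := hV) hm hw]
  exact ⟨fun h => h.swap'.swap, fun h => h.swap.swap'⟩

/-- An old edge lies in one triple and is traversed once by `w`. -/
theorem hasTwoTriangles_zigzag_ll (hm : 3 ≤ m) (hw : IsEulerianCircuit w)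
    (hT : T.IsSteinerTripleSystem) {a b : V} (hab : a ≠ b) :
    (zigzag T w hV).HasTwoTriangles (.inl a) (.inl b) := by
  obtain ⟨c, hc⟩ := hT.exists_third hab
  obtain ⟨i, -, hi⟩ := hw.surjOn (show s(a, b) ∈ {e : Sym2 V | ¬ e.IsDiag} by simpa using hab)
  refine ⟨.inl c, .inr i, by simp, ?_⟩
  rintro (x | j)
  · rw [zigzag_isTriangle_lll hm hw, hc]
    simp
  · rw [zigzag_isTriangle_llr hm hw]
    have : j = i ↔ s(w j, w (finRotate m j)) = s(a, b) := by
      rw [← hi]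
      exact ⟨fun h => by rw [h], fun h => hw.injOn (Set.mem_univ _) (Set.mem_univ _) h⟩
    simp only [reduceCtorEq, Sum.inr.injEq, false_or, this, Sym2.eq_iff]
    tauto

theorem hasTwoTriangles_zigzag_lr (hm : 3 ≤ m) (hw : IsEulerianCircuit w) {a : V} {i : Fin m}
    (h : a = w i ∨ a = w (finRotate m i)) :
    (zigzag T w hV).HasTwoTriangles (.inl a) (.inr i) := by
  have hi := hw.ne i
  rcases h with rfl | rfl
  · refine ⟨.inl (w (finRotate m i)), .inr ((finRotate m).symm i), by simp, ?_⟩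
    rintro (x | j)
    · simp [zigzag_isTriangle_lrl hm hw, hi, -finRotate_apply]
    · rw [zigzag_isTriangle_lrr hm hw]
      simp only [reduceCtorEq, Sum.inr.injEq, false_or, and_true, Equiv.eq_symm_apply,
        eq_comm (a := i)]
      refine ⟨fun h => h.resolve_left ?_, Or.inr⟩
      rintro ⟨rfl, h⟩
      exact hi h
  · refine ⟨.inl (w i), .inr (finRotate m i), by simp, ?_⟩
    rintro (x | j)
    · simp [zigzag_isTriangle_lrl hm hw, hi.symm, -finRotate_apply]
    · rw [zigzag_isTriangle_lrr hm hw]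
      simp only [reduceCtorEq, Sum.inr.injEq, false_or]
      refine ⟨fun h => (h.resolve_right fun h => hi.symm h.2).1, ?_⟩
      rintro rfl
      exact Or.inl ⟨rfl, rfl⟩

theorem hasTwoTriangles_zigzag_rr (hm : 3 ≤ m) (hw : IsEulerianCircuit w) {i j : Fin m}
    (hij : i < j) (h : (j : ℕ) = i + 1 ∨ (i : ℕ) = 0) :
    (zigzag T w hV).HasTwoTriangles (.inr i) (.inr j) := by
  have hj := j.2
  rw [Fin.lt_def] at hij
  by_cases h0 : (i : ℕ) = 0
  · by_cases h1 : (j : ℕ) = 1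
    · refine ⟨.inl (w j), .inr ⟨2, by omega⟩, by simp, ?_⟩
      rintro (x | k)
      · simp only [zigzag_isTriangle_rrl hm hw, eq_finRotate_iff, Sum.inl.injEq, reduceCtorEq,
          or_false]
        refine ⟨?_, fun h => Or.inl ⟨by omega, h⟩⟩
        rintro (h | h)
        · exact h.2
        · omega
      · simp only [zigzag_isTriangle_rrr hm hw, Sum.inr.injEq, reduceCtorEq, false_or, Fin.ext_iff]
        omega
    by_cases h2 : (j : ℕ) + 1 = m
    · refine ⟨.inl (w i), .inr ⟨j - 1, by omega⟩, by simp, ?_⟩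
      rintro (x | k)
      · simp only [zigzag_isTriangle_rrl hm hw, eq_finRotate_iff, Sum.inl.injEq, reduceCtorEq,
          or_false]
        refine ⟨?_, fun h => Or.inr ⟨by omega, h⟩⟩
        rintro (h | h)
        · omega
        · exact h.2
      · simp only [zigzag_isTriangle_rrr hm hw, Sum.inr.injEq, reduceCtorEq, false_or, Fin.ext_iff]
        omega
    · refine ⟨.inr ⟨j - 1, by omega⟩, .inr ⟨j + 1, by omega⟩, by simp, ?_⟩
      rintro (x | k)
      · simp only [zigzag_isTriangle_rrl hm hw, eq_finRotate_iff, reduceCtorEq, or_false, iff_false]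
        omega
      · simp only [zigzag_isTriangle_rrr hm hw, Sum.inr.injEq, Fin.ext_iff]
        omega
  · refine ⟨.inl (w j), .inr 0, by simp, ?_⟩
    rintro (x | k)
    · simp only [zigzag_isTriangle_rrl hm hw, eq_finRotate_iff, Sum.inl.injEq, reduceCtorEq,
        or_false]
      refine ⟨?_, fun h => Or.inl ⟨by omega, h⟩⟩
      rintro (h | h)
      · exact h.2
      · omega
    · simp only [zigzag_isTriangle_rrr hm hw, Sum.inr.injEq, reduceCtorEq, false_or, Fin.ext_iff,
        Fin.val_zero]
      omega

theorem isPure_zigzag (hm : 3 ≤ m) (hw : IsEulerianCircuit w) : (zigzag T w hV).IsPure 2 :=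
  isPure_ofFacets fun _ ht => card_of_mem_zigzagTriangles hm hw ht

theorem hasTwoTriangles_zigzag (hm : 3 ≤ m) (hw : IsEulerianCircuit w)
    (hT : T.IsSteinerTripleSystem) {a b : V ⊕ Fin m} (hab : (zigzag T w hV).oneSkeleton.Adj a b) :
    (zigzag T w hV).HasTwoTriangles a b := by
  obtain ⟨x, hx⟩ := (isPure_zigzag hm hw).exists_isTriangle hab
  have lr : ∀ {a i}, (zigzag T w hV).IsTriangle (.inl a) (.inr i) x →
      (zigzag T w hV).HasTwoTriangles (.inl a) (.inr i) := by
    intro a i h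
    refine hasTwoTriangles_zigzag_lr hm hw ?_
    rcases x with x | j
    · rw [zigzag_isTriangle_lrl hm hw] at h
      tauto
    · rw [zigzag_isTriangle_lrr hm hw] at h
      rcases h with ⟨rfl, h⟩ | ⟨-, h⟩ <;> tauto
  have rr : ∀ {i j}, i < j → (zigzag T w hV).IsTriangle (.inr i) (.inr j) x →
      (zigzag T w hV).HasTwoTriangles (.inr i) (.inr j) := by
    intro i j hij h
    refine hasTwoTriangles_zigzag_rr hm hw hij ?_
    rw [Fin.lt_def] at hij
    rcases x with x | k
    · simp only [zigzag_isTriangle_rrl hm hw, eq_finRotate_iff] at h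
      omega
    · simp only [zigzag_isTriangle_rrr hm hw] at h
      omega
  rcases a with a | i <;> rcases b with b | j
  · exact hasTwoTriangles_zigzag_ll hm hw hT fun h => hx.1 (congrArg _ h)
  · exact lr hx
  · exact (lr hx.swap).symm
  · rcases lt_trichotomy i j with hij | rfl | hij
    · exact rr hij hx
    · exact absurd rfl hx.1
    · exact (rr hij hx.swap).symm

theorem connected_oneSkeleton_zigzag (hm : 3 ≤ m) (hw : IsEulerianCircuit w)
    (hT : T.IsSteinerTripleSystem) : (zigzag T w hV).oneSkeleton.Connected := by
  have key : ∀ a : V ⊕ Fin m, (zigzag T w hV).oneSkeleton.Reachable a (.inl (w 0)) := by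
    have left : ∀ a : V, (zigzag T w hV).oneSkeleton.Reachable (.inl a) (.inl (w 0)) := by
      intro a
      rcases eq_or_ne a (w 0) with rfl | ha
      · exact .refl _
      · obtain ⟨c, hc⟩ := hT.exists_third ha
        exact ((zigzag_isTriangle_lll hm hw).2 ((hc c).2 rfl)).adj.reachable
    rintro (a | i)
    · exact left a
    · have : (zigzag T w hV).IsTriangle (.inl (w i)) (.inr i) (.inl (w (finRotate m i))) :=
        (zigzag_isTriangle_lrl hm hw).2 (Or.inl ⟨rfl, rfl⟩)
      exact this.swap.adj.reachable.trans (left _)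
  exact (SimpleGraph.connected_iff _).2 ⟨fun a b => (key a).trans (key b).symm, ⟨.inl (w 0)⟩⟩

/-- In the link of an old vertex `v`, a passage `a, v, b` of `w` is replaced by the path from `a` to
`b` over the two new vertices of the zigzag at this passage. -/
theorem link_zigzag_inl (hm : 3 ≤ m) (hw : T.IsCellBoundary w) (v : V) {a b : V ⊕ Fin m}
    (ha : (zigzag T w hV).oneSkeleton.Adj (.inl v) a)
    (hb : (zigzag T w hV).oneSkeleton.Adj (.inl v) b) :
    Relation.EqvGen ((zigzag T w hV).IsTriangle (.inl v)) a b := by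
  have he := hw.eulerian
  -- every neighbour is joined in the link to an old vertex
  have old : ∀ a, (zigzag T w hV).oneSkeleton.Adj (.inl v) a →
      ∃ x, x ≠ v ∧ Relation.EqvGen ((zigzag T w hV).IsTriangle (.inl v)) a (.inl x) := by
    rintro (x | i) ha
    · exact ⟨x, fun h => ha.1 (congrArg _ h.symm), .refl _⟩
    · obtain ⟨x, hx⟩ := (isPure_zigzag hm he).exists_isTriangle ha
      have : v = w i ∨ v = w (finRotate m i) := by
        rcases x with x | j
        · rw [zigzag_isTriangle_lrl hm he] at hx
          tauto
        · rw [zigzag_isTriangle_lrr hm he] at hx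
          rcases hx with ⟨rfl, h⟩ | ⟨-, h⟩ <;> tauto
      rcases this with rfl | rfl
      · exact ⟨_, (he.ne i).symm, .rel _ _ ((zigzag_isTriangle_lrl hm he).2 (Or.inl ⟨rfl, rfl⟩))⟩
      · exact ⟨_, he.ne i, .rel _ _ ((zigzag_isTriangle_lrl hm he).2 (Or.inr ⟨rfl, rfl⟩))⟩
  have lift : ∀ x y, Relation.EqvGen (fun a b => T.IsTriangle v a b ∨
      ∃ i, w i = a ∧ w (finRotate m i) = v ∧ w (finRotate m (finRotate m i)) = b) x y →
      Relation.EqvGen ((zigzag T w hV).IsTriangle (.inl v)) (.inl x) (.inl y) := by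
    intro x y h
    induction h with
    | rel x y h =>
      rcases h with h | ⟨i, rfl, rfl, rfl⟩
      · exact .rel _ _ ((zigzag_isTriangle_lll hm he).2 h)
      · -- the two new vertices between consecutive sides of the cell
        refine .trans _ (.inr i) _ (.symm _ _ (.rel _ _ ?_)) (.trans _ (.inr (finRotate m i)) _
          (.rel _ _ ?_) (.rel _ _ ?_))
        · exact (zigzag_isTriangle_lrl hm he).2 (Or.inr ⟨rfl, rfl⟩)
        · exact (zigzag_isTriangle_lrr hm he).2 (Or.inl ⟨rfl, rfl⟩)
        · exact (zigzag_isTriangle_lrl hm he).2 (Or.inl ⟨rfl, rfl⟩)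
    | refl x => exact .refl _
    | symm x y _ ih => exact ih.symm
    | trans x y z _ _ ih1 ih2 => exact ih1.trans _ _ _ ih2
  obtain ⟨x, hx, hax⟩ := old a ha
  obtain ⟨y, hy, hby⟩ := old b hb
  exact (hax.trans _ _ _ (lift x y (hw.link v x y hx hy))).trans _ _ _ hby.symm

theorem link_zigzag_inr (hm : 3 ≤ m) (hw : IsEulerianCircuit w) (i : Fin m) {a b : V ⊕ Fin m}
    (ha : (zigzag T w hV).oneSkeleton.Adj (.inr i) a)
    (hb : (zigzag T w hV).oneSkeleton.Adj (.inr i) b) :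
    Relation.EqvGen ((zigzag T w hV).IsTriangle (.inr i)) a b := by
  have h1 : Relation.EqvGen ((zigzag T w hV).IsTriangle (.inr i)) (.inl (w i))
      (.inl (w (finRotate m i))) :=
    .rel _ _ ((zigzag_isTriangle_lrl hm hw).2 (Or.inl ⟨rfl, rfl⟩)).swap
  have next : ∀ j, j = finRotate m i →
      Relation.EqvGen ((zigzag T w hV).IsTriangle (.inr i)) (.inr j) (.inl (w i)) := by
    rintro _ rfl
    exact (h1.trans _ _ _ (.rel _ _
      ((zigzag_isTriangle_lrr hm hw).2 (Or.inl ⟨rfl, rfl⟩)).swap)).symm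
  have prev : ∀ j, i = finRotate m j →
      Relation.EqvGen ((zigzag T w hV).IsTriangle (.inr i)) (.inr j) (.inl (w i)) := by
    rintro j h
    exact .symm _ _ (.rel _ _ ((zigzag_isTriangle_lrr hm hw).2 (Or.inr ⟨h, rfl⟩)).swap)
  -- all neighbours are joined to `w i`, the new ones over the two neighbours of `i` on the polygon
  have key : ∀ a, (zigzag T w hV).oneSkeleton.Adj (.inr i) a →
      Relation.EqvGen ((zigzag T w hV).IsTriangle (.inr i)) a (.inl (w i)) := by
    intro a ha
    obtain ⟨x, hx⟩ := (isPure_zigzag hm hw).exists_isTriangle ha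
    rcases a with v | j
    · have : v = w i ∨ v = w (finRotate m i) := by
        rcases x with x | j
        · have := (zigzag_isTriangle_lrl hm hw).1 hx.swap
          tauto
        · have := (zigzag_isTriangle_lrr hm hw).1 hx.swap
          rcases this with ⟨rfl, h⟩ | ⟨-, h⟩ <;> tauto
      rcases this with rfl | rfl
      · exact .refl _
      · exact h1.symm
    · rcases x with x | k
      · rcases (zigzag_isTriangle_rrl hm hw).1 hx with ⟨h, -⟩ | ⟨h, -⟩
        exacts [next j h, prev j h]
      · rw [zigzag_isTriangle_rrr hm hw] at hx
        by_cases hi : (i : ℕ) = 0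
        · -- the vertex `0` of the fan: walk from `1` to `j`
          have walk : ∀ n (hn : n + 1 < m), Relation.EqvGen ((zigzag T w hV).IsTriangle (.inr i))
              (.inr ⟨n + 1, hn⟩) (.inl (w i)) := by
            intro n
            induction n with
            | zero => exact fun hn => next _ (eq_finRotate_iff.2 (Or.inr ⟨by omega, by simp [hi]⟩))
            | succ n ih =>
              intro hn
              refine .trans _ _ _ (.rel _ _ ?_) (ih (by omega))
              rw [zigzag_isTriangle_rrr hm hw]
              dsimp only
              omega
          have := walk (j - 1) (by omega)
          convert this using 3
          omega
        · by_cases hj : (j : ℕ) = 0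
          · by_cases hi' : (i : ℕ) + 1 = m
            · exact next j (eq_finRotate_iff.2 (by omega))
            · have := i.2
              refine .trans _ (.inr ⟨i + 1, by omega⟩) _ (.rel _ _ ?_)
                (next _ (eq_finRotate_iff.2 (Or.inr ⟨hi', rfl⟩)))
              rw [zigzag_isTriangle_rrr hm hw]
              dsimp only
              omega
          · have := i.2
            have := j.2
            rcases (by omega : (j : ℕ) = i + 1 ∨ (i : ℕ) = j + 1) with h | h
            · exact next j (eq_finRotate_iff.2 (by omega))
            · exact prev j (eq_finRotate_iff.2 (by omega))
  exact (key a ha).trans _ _ _ (key b hb).symm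

theorem isClosedSurface_zigzag (hm : 3 ≤ m) (hw : T.IsCellBoundary w)
    (hT : T.IsSteinerTripleSystem) : (zigzag T w hV).IsClosedSurface :=
  isClosedSurface_of_hasTwoTriangles (isPure_zigzag hm hw.eulerian)
    (connected_oneSkeleton_zigzag hm hw.eulerian hT)
    (fun v _ _ ha hb => by
      rcases v with v | i
      exacts [link_zigzag_inl hm hw v ha hb, link_zigzag_inr hm hw.eulerian i ha hb])
    fun _ _ h => hasTwoTriangles_zigzag hm hw.eulerian hT h

end

end AbstractSimplicialComplex

/-! ### Orientability of the zigzag completion -/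

namespace AbstractSimplicialComplex

variable {V : Type*} [DecidableEq V] [Fintype V] {m : ℕ} [NeZero m]
  {T : AbstractSimplicialComplex V} {w : Fin m → V} {hV : ∀ v, ∃ t ∈ T.triples, v ∈ t}

/-- The orientation of the completion if `w` runs around all triples cyclically: the triangles in
the cell are oriented like the cell with boundary `w`, and the triples opposite to the direction of
`w`. Triangles with three new vertices follow the cyclic order of the inner polygon. -/
def zigzagOrientation {V : Type*} {m : ℕ} (w : Fin m → V) :
    V ⊕ Fin m → V ⊕ Fin m → V ⊕ Fin m → Prop
  | .inl a, .inl b, .inl _ => IsDart w b a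
  | .inl a, .inl b, .inr _ => IsDart w a b
  | .inl a, .inr _, .inl c => IsDart w c a
  | .inr _, .inl b, .inl c => IsDart w b c
  | .inl _, .inr i, .inr j => i = finRotate m j
  | .inr i, .inr j, .inl _ => i = finRotate m j
  | .inr j, .inl _, .inr i => i = finRotate m j
  | .inr i, .inr j, .inr k => (i < j ∧ j < k) ∨ (j < k ∧ k < i) ∨ (k < i ∧ i < j)

theorem zigzagOrientation_rotate
    (hcoh : ∀ a b c, T.IsTriangle a b c → IsDart w a b → IsDart w b c)
    (hm : 3 ≤ m) (hw : IsEulerianCircuit w) {a b c : V ⊕ Fin m}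
    (h : (zigzag T w hV).IsTriangle a b c) :
    zigzagOrientation w a b c ↔ zigzagOrientation w b c a := by
  rcases a with a | i <;> rcases b with b | j <;> rcases c with c | k <;>
    simp only [zigzagOrientation]
  · rw [zigzag_isTriangle_lll hm hw] at h
    exact ⟨fun h' => hcoh _ _ _ h.swap' (hcoh _ _ _ h.swap h'),
      fun h' => hcoh _ _ _ h.swap'.swap.swap' h'⟩
  · tauto

theorem eq_finRotate_iff_not {m : ℕ} (hm : 3 ≤ m) {i j : Fin m}
    (h : i = finRotate m j ∨ j = finRotate m i) :
    i = finRotate m j ↔ ¬ j = finRotate m i := by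
  rw [eq_finRotate_iff, eq_finRotate_iff] at *
  omega

theorem zigzagOrientation_swap (hm : 3 ≤ m) (hw : IsEulerianCircuit w) {a b c : V ⊕ Fin m}
    (h : (zigzag T w hV).IsTriangle a b c) :
    zigzagOrientation w a b c ↔ ¬ zigzagOrientation w b a c := by
  have hl : ∀ {x y : V} {z}, (zigzag T w hV).IsTriangle (.inl x) (.inl y) z → x ≠ y :=
    fun h hxy => h.1 (congrArg _ hxy)
  have hr : ∀ {i j : Fin m} {x : V}, (zigzag T w hV).IsTriangle (.inl x) (.inr i) (.inr j) →
      i = finRotate m j ∨ j = finRotate m i := fun h => by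
    rw [zigzag_isTriangle_lrr hm hw] at h
    tauto
  rcases a with a | i <;> rcases b with b | j <;> rcases c with c | k <;>
    simp only [zigzagOrientation]
  · exact hw.isDart_iff (hl h).symm
  · exact hw.isDart_iff (hl h)
  · exact hw.isDart_iff (hl h.swap').symm
  · exact eq_finRotate_iff_not hm (hr h)
  · exact hw.isDart_iff (hl h.swap.swap')
  · exact eq_finRotate_iff_not hm (hr h.swap).symm
  · exact eq_finRotate_iff_not hm (hr h.swap'.swap)
  · have hij : i ≠ j := fun h' => h.1 (congrArg _ h')
    have hik : i ≠ k := fun h' => h.2.1 (congrArg _ h')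
    have hjk : j ≠ k := fun h' => h.2.2.1 (congrArg _ h')
    simp only [Fin.lt_def, Ne, Fin.ext_iff] at *
    omega

theorem zigzagOrientation_coherent (hm : 3 ≤ m) (hw : IsEulerianCircuit w)
    (hT : T.IsSteinerTripleSystem) {a b c d : V ⊕ Fin m}
    (h : (zigzag T w hV).IsTriangle a b c) (h' : (zigzag T w hV).IsTriangle a b d) (hcd : c ≠ d) :
    zigzagOrientation w a b c ↔ zigzagOrientation w b a d := by
  have lr : ∀ {a : V} {i : Fin m} {c d : V ⊕ Fin m},
      (zigzag T w hV).IsTriangle (.inl a) (.inr i) c →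
      (zigzag T w hV).IsTriangle (.inl a) (.inr i) d → c ≠ d →
      (zigzagOrientation w (.inl a) (.inr i) c ↔ zigzagOrientation w (.inr i) (.inl a) d) := by
    intro a i c d h h' hcd
    have hi := hw.ne i
    have hd : IsDart w (w i) (w (finRotate m i)) := ⟨i, rfl, rfl⟩
    have hd' := hd.not_symm hw
    have hrr := finRotate_finRotate_ne hm
    rcases c with c | j <;> rcases d with d | k <;> simp only [zigzagOrientation]
    · rw [zigzag_isTriangle_lrl hm hw] at h h'
      exfalso
      rcases h with ⟨rfl, rfl⟩ | ⟨rfl, rfl⟩ <;> rcases h' with ⟨h1, rfl⟩ | ⟨h1, rfl⟩ <;> tauto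
    · rw [zigzag_isTriangle_lrl hm hw] at h
      rw [zigzag_isTriangle_lrr hm hw] at h'
      rcases h with ⟨rfl, rfl⟩ | ⟨rfl, rfl⟩ <;> rcases h' with ⟨rfl, h1⟩ | ⟨rfl, h1⟩
      · exact absurd h1 hi
      · simpa [hd', -finRotate_apply] using (hrr k).symm
      · simpa [-finRotate_apply] using hd
      · exact absurd h1.symm (hw.ne _)
    · rw [zigzag_isTriangle_lrl hm hw] at h'
      rw [zigzag_isTriangle_lrr hm hw] at h
      rcases h' with ⟨rfl, rfl⟩ | ⟨rfl, rfl⟩ <;> rcases h with ⟨rfl, h1⟩ | ⟨rfl, h1⟩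
      · exact absurd h1 hi
      · simpa [-finRotate_apply] using hd
      · simpa [hd', -finRotate_apply] using (hrr i).symm
      · exact absurd h1.symm (hw.ne _)
    · rw [zigzag_isTriangle_lrr hm hw] at h h'
      rcases h with ⟨rfl, rfl⟩ | ⟨h, rfl⟩ <;> rcases h' with ⟨rfl, h1⟩ | ⟨h2, h1⟩
      · exact absurd rfl hcd
      · exact absurd h1.symm hi
      · exact absurd h1 hi
      · exact absurd (congrArg Sum.inr ((finRotate m).injective (h.symm.trans h2))) hcd
  rcases a with a | i <;> rcases b with b | j
  · rcases c with c | j <;> rcases d with d | k <;> simp only [zigzagOrientation]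
    · rw [zigzag_isTriangle_lll hm hw] at h h'
      obtain ⟨e, he⟩ := hT.exists_third h.1
      exact absurd (congrArg Sum.inl (((he c).1 h).trans ((he d).1 h').symm)) hcd
    · rw [zigzag_isTriangle_llr hm hw] at h h'
      refine absurd (congrArg Sum.inr (hw.injOn (Set.mem_univ j) (Set.mem_univ k) ?_)) hcd
      rw [Sym2.eq_iff]
      rcases h with ⟨rfl, rfl⟩ | ⟨rfl, rfl⟩ <;> tauto
  · exact lr h h' hcd
  · exact (lr h'.swap h.swap hcd.symm).symm
  · have hij : i ≠ j := fun h' => h.1 (congrArg _ h')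
    have hik : ∀ {k}, (zigzag T w hV).IsTriangle (.inr i) (.inr j) (.inr k) → i ≠ k ∧ j ≠ k :=
      fun h => ⟨fun h' => h.2.1 (congrArg _ h'), fun h' => h.2.2.1 (congrArg _ h')⟩
    rcases c with c | k <;> rcases d with d | l <;> simp only [zigzagOrientation]
    · rw [zigzag_isTriangle_rrl hm hw] at h h'
      refine absurd (congrArg Sum.inl ?_) hcd
      have := eq_finRotate_iff_not hm (i := i) (j := j)
      rcases h with ⟨h1, rfl⟩ | ⟨h1, rfl⟩ <;> rcases h' with ⟨h2, rfl⟩ | ⟨h2, rfl⟩ <;> tauto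
    · obtain ⟨hil, hjl⟩ := hik h'
      rw [zigzag_isTriangle_rrl hm hw] at h
      rw [zigzag_isTriangle_rrr hm hw] at h'
      rw [eq_finRotate_iff, eq_finRotate_iff] at h
      rw [eq_finRotate_iff]
      simp only [Fin.lt_def]
      simp only [Ne, Fin.ext_iff] at hij hil hjl
      omega
    · obtain ⟨hil, hjl⟩ := hik h
      rw [zigzag_isTriangle_rrl hm hw] at h'
      rw [zigzag_isTriangle_rrr hm hw] at h
      rw [eq_finRotate_iff, eq_finRotate_iff] at h'
      rw [eq_finRotate_iff]
      simp only [Fin.lt_def]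
      simp only [Ne, Fin.ext_iff] at hij hil hjl
      omega
    · obtain ⟨hil, hjl⟩ := hik h'
      obtain ⟨hik, hjk⟩ := hik h
      have hkl : k ≠ l := fun h => hcd (congrArg _ h)
      rw [zigzag_isTriangle_rrr hm hw] at h h'
      simp only [Fin.lt_def, Ne, Fin.ext_iff] at *
      omega

theorem isOrientable_zigzag (hm : 3 ≤ m) (hw : IsEulerianCircuit w) (hT : T.IsSteinerTripleSystem)
    (hcoh : ∀ a b c, T.IsTriangle a b c → IsDart w a b → IsDart w b c) :
    (zigzag T w hV).IsOrientable :=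
  ⟨zigzagOrientation w, fun _ _ _ h => zigzagOrientation_rotate hcoh hm hw h,
    fun _ _ _ h => zigzagOrientation_swap hm hw h,
    fun _ _ _ _ h h' hcd => zigzagOrientation_coherent hm hw hT h h' hcd⟩

/-- An orientation is constant along the annulus, hence along `w`. If `w` leaves the vertex `a` of a
triple along both sides, then it induces opposite orientations on this triple. -/
theorem not_isOrientable_zigzag (hm : 3 ≤ m) (hw : IsEulerianCircuit w) {a b c : V}
    (habc : T.IsTriangle a b c) (hab : IsDart w a b) (hac : IsDart w a c) :
    ¬ (zigzag T w hV).IsOrientable := by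
  rintro ⟨P, rot, swap, coh⟩
  set K := zigzag T w hV
  have outer : ∀ i, K.IsTriangle (.inl (w i)) (.inl (w (finRotate m i))) (.inr i) := fun i =>
    (zigzag_isTriangle_llr hm hw).2 (Or.inl ⟨rfl, rfl⟩)
  have inner : ∀ i, K.IsTriangle (.inl (w (finRotate m i))) (.inr i) (.inr (finRotate m i)) :=
    fun i => (zigzag_isTriangle_lrr hm hw).2 (Or.inl ⟨rfl, rfl⟩)
  -- the orientation is constant along the annulus
  have step : ∀ i, P (.inl (w i)) (.inl (w (finRotate m i))) (.inr i) ↔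
      P (.inl (w (finRotate m i))) (.inl (w (finRotate m (finRotate m i))))
        (.inr (finRotate m i)) := by
    intro i
    have o1 := outer i
    have o2 := outer (finRotate m i)
    have n := inner i
    rw [rot _ _ _ o1, coh _ _ _ _ o1.swap.swap' n (by simp), rot _ _ _ n.swap,
      coh _ _ _ _ n.swap' o2.swap' (by simp)]
    exact rot _ _ _ o2.swap'.swap
  have const : ∀ i, P (.inl (w i)) (.inl (w (finRotate m i))) (.inr i) ↔
      P (.inl (w 0)) (.inl (w (finRotate m 0))) (.inr 0) := by
    rintro ⟨n, hn⟩
    induction n with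
    | zero => exact Iff.rfl
    | succ n ih =>
      rw [← ih (by omega), step ⟨n, by omega⟩]
      have : finRotate m ⟨n, by omega⟩ = ⟨n + 1, hn⟩ :=
        (eq_finRotate_iff.2 (Or.inr ⟨by dsimp only; omega, rfl⟩)).symm
      rw [this]
  obtain ⟨i, rfl, rfl⟩ := hab
  obtain ⟨j, hj, rfl⟩ := hac
  have t : K.IsTriangle (.inl (w i)) (.inl (w (finRotate m i))) (.inl (w (finRotate m j))) :=
    (zigzag_isTriangle_lll hm hw).2 habc
  have oi := outer i
  have oj := outer j
  rw [hj] at oj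
  have e1 := (coh _ _ _ _ t oi (by simp)).trans
    ((not_congr (swap _ _ _ oi)).trans not_not).symm
  have e2 := (coh _ _ _ _ t.swap' oj (by simp)).trans
    ((not_congr (swap _ _ _ oj)).trans not_not).symm
  have hi := const i
  have hj' := const j
  rw [hj] at hj'
  rw [hi] at e1
  rw [hj', rot _ _ _ t.swap', rot _ _ _ t.swap'.swap.swap', ← e1, swap _ _ _ t] at e2
  exact iff_not_self e2

end AbstractSimplicialComplex

/-! ### Surface extensions of Steiner triple systems -/

namespace AbstractSimplicialComplex

theorem faceNumber_two_zigzag {V : Type*} [DecidableEq V] [Fintype V] {m : ℕ} [NeZero m]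
    {T : AbstractSimplicialComplex V} {w : Fin m → V} {hV : ∀ v, ∃ t ∈ T.triples, v ∈ t}
    (hm : 3 ≤ m) (hw : IsEulerianCircuit w) :
    (zigzag T w hV).faceNumber 2 + 2 = T.triples.card + 3 * m := by
  have : {t : Finset (V ⊕ Fin m) | t ∈ zigzag T w hV ∧ t.card = 2 + 1} =
      (zigzagTriangles T w : Set (Finset (V ⊕ Fin m))) := by
    ext t
    exact mem_ofFacets_iff_of_card_eq fun t ht => card_of_mem_zigzagTriangles hm hw ht
  rw [faceNumber, this, Set.ncard_coe_finset, card_zigzagTriangles hm]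
  have := (isPolygonTriangulation_fan hm).card_add_two
  omega

theorem IsSteinerTripleSystem.map_inl_mem_zigzag {V : Type*} [DecidableEq V] [Fintype V] {m : ℕ}
    [NeZero m] {T : AbstractSimplicialComplex V} (hT : T.IsSteinerTripleSystem) {w : Fin m → V}
    {hV : ∀ v, ∃ t ∈ T.triples, v ∈ t} {t : Finset V} (ht : t ∈ T) :
    t.map Function.Embedding.inl ∈ zigzag T w hV := by
  obtain ⟨-, u, hu, htu, hcard⟩ := hT.pure t ht
  refine mem_ofFacets.2 ⟨(T.isRelLowerSet_faces ht).1.map, u.disjSum ∅,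
    mem_zigzagTriangles.2 ?_, ?_⟩
  · left
    rw [Finset.toLeft_disjSum, Finset.toRight_disjSum, mem_triples]
    exact ⟨⟨hu, hcard⟩, rfl⟩
  · rw [Finset.disjSum_empty]
    exact Finset.map_subset_map.2 htu

theorem isSurfaceExtension_zigzag {n : ℕ} (hn : 3 < n) [NeZero (n.choose 2)]
    {T : AbstractSimplicialComplex (Fin n)} (hT : T.IsSteinerTripleSystem)
    {w : Fin (n.choose 2) → Fin n} (hw : T.IsCellBoundary w) {hV : ∀ v, ∃ t ∈ T.triples, v ∈ t} :
    T.IsSurfaceExtension (zigzag T w hV) := by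
  have hm : 3 ≤ n.choose 2 := by
    have := Nat.choose_le_choose 2 hn
    rw [show Nat.choose (3 + 1) 2 = 6 from rfl] at this
    omega
  have he := hw.eulerian
  have ht : 3 * (T.triples.card : ℚ) = n.choose 2 := by
    have := hT.card_triples
    rw [Fintype.card_fin] at this
    exact_mod_cast this
  have h0 : ((zigzag T w hV).faceNumber 0 : ℚ) = n + n.choose 2 := by
    rw [faceNumber_zero_eq]
    simp
  have h2 : ((zigzag T w hV).faceNumber 2 : ℚ) = 1 / 3 * n.choose 2 + 3 * n.choose 2 - 2 := by
    have : ((zigzag T w hV).faceNumber 2 : ℚ) + 2 = T.triples.card + 3 * n.choose 2 := by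
      exact_mod_cast faceNumber_two_zigzag hm he
    linarith
  have h1 : ((zigzag T w hV).faceNumber 1 : ℚ) = 5 * n.choose 2 - 3 := by
    have : 2 * ((zigzag T w hV).faceNumber 1 : ℚ) = 3 * (zigzag T w hV).faceNumber 2 := by
      exact_mod_cast two_mul_faceNumber_one fun a b h => hasTwoTriangles_zigzag hm he hT h
    linarith
  refine ⟨isClosedSurface_zigzag hm hw hT, fun t ht => hT.map_inl_mem_zigzag ht,
    ⟨w, fan _, he, isPolygonTriangulation_fan hm, isZigzagCompletion_zigzag hm he⟩, h0, h1, h2, ?_,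
    chromaticNumber_le_of_map_mem _ (fun t ht => hT.map_inl_mem_zigzag ht) 2⟩
  rw [(isPure_zigzag hm he).eulerChar_eq (by simp; omega)]
  push_cast
  rw [h0, h1, h2, Nat.cast_choose_two]
  ring

theorem IsSteinerTripleSystem.exists_isSurfaceExtension {n : ℕ} (hn : 3 < n)
    {T : AbstractSimplicialComplex (Fin n)} (hT : T.IsSteinerTripleSystem) :
    (∃ K, T.IsSurfaceExtension K ∧ K.IsOrientable) ∧
      ∃ K, T.IsSurfaceExtension K ∧ ¬ K.IsOrientable := by
  have : NeZero (n.choose 2) := ⟨(Nat.choose_pos (by omega)).ne'⟩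
  have : Nontrivial (Fin n) := Fin.nontrivial_iff_two_le.2 (by omega)
  have hm : 3 ≤ n.choose 2 := by
    have := Nat.choose_le_choose 2 hn
    rw [show Nat.choose (3 + 1) 2 = 6 from rfl] at this
    omega
  have hcard : n.choose 2 = (Fintype.card (Fin n)).choose 2 := by rw [Fintype.card_fin]
  constructor
  · obtain ⟨w, hw, hcoh⟩ := hT.exists_coherent_circuit hcard
    exact ⟨zigzag T w hT.exists_mem_triples, isSurfaceExtension_zigzag hn hT hw,
      isOrientable_zigzag hm hw.eulerian hT hcoh⟩
  · obtain ⟨w, hw, a, b, c, habc, hab, hac⟩ := hT.exists_incoherent_circuit hcard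
      (by simpa using hn)
    exact ⟨zigzag T w hT.exists_mem_triples, isSurfaceExtension_zigzag hn hT hw,
      not_isOrientable_zigzag hm hw.eulerian habc hab hac⟩

/-! ### Relabelling the vertices -/

section Relabel

variable {V W : Type*}

/-- The complex `K` with its vertices renamed along `e`. -/
def relabel (K : AbstractSimplicialComplex V) (e : V ≃ W) : AbstractSimplicialComplex W where
  faces := {t | t.map e.symm.toEmbedding ∈ K}
  isRelLowerSet_faces := by
    intro t ht
    exact ⟨Finset.map_nonempty.1 (K.isRelLowerSet_faces ht).1,
      fun s hst hs => mem_of_subset ht (Finset.map_subset_map.2 hst) hs.map⟩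
  singleton_mem v := by
    change Finset.map _ _ ∈ K
    rw [Finset.map_singleton]
    exact K.singleton_mem _

variable {K : AbstractSimplicialComplex V} {e : V ≃ W}

theorem mem_relabel {t : Finset W} : t ∈ K.relabel e ↔ t.map e.symm.toEmbedding ∈ K := Iff.rfl

theorem map_mem_relabel {t : Finset V} : t.map e.toEmbedding ∈ K.relabel e ↔ t ∈ K := by
  rw [mem_relabel, Finset.map_map]
  convert Iff.rfl
  ext
  simp

theorem chromaticNumber_le_relabel (s : ℕ) :
    K.chromaticNumber s ≤ (K.relabel e).chromaticNumber s :=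
  chromaticNumber_le_of_map_mem e.toEmbedding (fun _ ht => map_mem_relabel.2 ht) s

variable [DecidableEq V] [DecidableEq W]

theorem relabel_isTriangle {a b c : V} :
    (K.relabel e).IsTriangle (e a) (e b) (e c) ↔ K.IsTriangle a b c := by
  simp [IsTriangle, ← map_mem_relabel (e := e) (t := {a, b, c}), Finset.map_insert]

/-- Renaming the vertices is an isomorphism of 1-skeleta. -/
def relabelIso (K : AbstractSimplicialComplex V) (e : V ≃ W) :
    K.oneSkeleton ≃g (K.relabel e).oneSkeleton where
  toEquiv := e
  map_rel_iff' := by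
    intro a b
    simp [oneSkeleton, ← map_mem_relabel (e := e) (t := {a, b}), Finset.map_insert]

/-- Renaming the vertices is an isomorphism of links. -/
def relabelLinkIso (K : AbstractSimplicialComplex V) (e : V ≃ W) (v : V) :
    K.linkGraph v ≃g (K.relabel e).linkGraph (e v) where
  toEquiv := e.subtypeEquiv fun _ => (relabelIso K e).map_adj_iff.symm
  map_rel_iff' := relabel_isTriangle

theorem IsClosedSurface.relabel (hK : K.IsClosedSurface) (e : V ≃ W) :
    (K.relabel e).IsClosedSurface where
  finite := have := hK.finite; .of_equiv V e
  pure t ht := by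
    obtain ⟨h, u, hu, htu, hcard⟩ := hK.pure _ ht
    refine ⟨by simpa using h, u.map e.toEmbedding, map_mem_relabel.2 hu, ?_, by simpa using hcard⟩
    intro x hx
    exact Finset.mem_map.2 ⟨e.symm x, htu (Finset.mem_map_of_mem _ hx), by simp⟩
  connected := (relabelIso K e).connected_iff.1 hK.connected
  link_connected v := by
    obtain ⟨v, rfl⟩ := e.surjective v
    exact (relabelLinkIso K e v).connected_iff.1 (hK.link_connected v)
  link_degree v a := by
    obtain ⟨v, rfl⟩ := e.surjective v
    obtain ⟨a, rfl⟩ := (relabelLinkIso K e v).surjective a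
    rw [← hK.link_degree v a, ← Nat.card_coe_set_eq, ← Nat.card_coe_set_eq]
    exact (Nat.card_congr ((relabelLinkIso K e v).mapNeighborSet a)).symm

theorem isOrientable_relabel_iff : (K.relabel e).IsOrientable ↔ K.IsOrientable := by
  constructor
  · rintro ⟨P, h1, h2, h3⟩
    exact ⟨fun a b c => P (e a) (e b) (e c), fun _ _ _ h => h1 _ _ _ (relabel_isTriangle.2 h),
      fun _ _ _ h => h2 _ _ _ (relabel_isTriangle.2 h),
      fun _ _ _ _ h h' hcd => h3 _ _ _ _ (relabel_isTriangle.2 h) (relabel_isTriangle.2 h')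
        (e.injective.ne hcd)⟩
  · rintro ⟨P, h1, h2, h3⟩
    have tri : ∀ {a b c : W}, (K.relabel e).IsTriangle a b c →
        K.IsTriangle (e.symm a) (e.symm b) (e.symm c) := fun h =>
      relabel_isTriangle (e := e).1 (by simpa using h)
    exact ⟨fun a b c => P (e.symm a) (e.symm b) (e.symm c), fun _ _ _ h => h1 _ _ _ (tri h),
      fun _ _ _ h => h2 _ _ _ (tri h),
      fun _ _ _ _ h h' hcd => h3 _ _ _ _ (tri h) (tri h') (e.symm.injective.ne hcd)⟩

end Relabel

/-! ### Steiner triple systems of large chromatic number -/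

/-- An upper bound for the number of vertices such that any colouring of the edges of the complete
graph with `s` colours has a monochromatic triangle. -/
def triangleRamseyBound : ℕ → ℕ
  | 0 => 2
  | s + 1 => (s + 1) * triangleRamseyBound s + 2

theorem triangleRamseyBound_mono : Monotone triangleRamseyBound :=
  monotone_nat_of_le_succ fun s => by
    rw [triangleRamseyBound]
    nlinarith [Nat.zero_le (s * triangleRamseyBound s)]

/-- The multicolour Ramsey theorem for triangles. -/
theorem exists_monochromatic_triangle {α C : Type*} [DecidableEq α] [DecidableEq C]
    (χ : α → α → C) (S : Finset C) (A : Finset α)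
    (hA : triangleRamseyBound S.card ≤ A.card)
    (hS : ∀ a ∈ A, ∀ b ∈ A, a ≠ b → χ a b ∈ S) :
    ∃ a ∈ A, ∃ b ∈ A, ∃ c ∈ A, a ≠ b ∧ a ≠ c ∧ b ≠ c ∧ χ a b = χ a c ∧ χ a b = χ b c := by
  induction hs : S.card generalizing S A with
  | zero =>
    rw [hs] at hA
    obtain ⟨a, ha, b, hb, hab⟩ := Finset.one_lt_card.1 (show 1 < A.card from hA)
    have := hS a ha b hb hab
    rw [Finset.card_eq_zero.1 hs] at this
    simp at this
  | succ s ih =>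
    rw [hs, triangleRamseyBound] at hA
    obtain ⟨a, ha⟩ := Finset.card_pos.1 (show 0 < A.card by omega)
    obtain ⟨i, hi, hfib⟩ := Finset.exists_lt_card_fiber_of_mul_lt_card_of_maps_to
      (s := A.erase a) (t := S) (f := χ a) (n := triangleRamseyBound s)
      (fun b hb => hS a ha b (Finset.mem_of_mem_erase hb) (Finset.ne_of_mem_erase hb).symm)
      (by rw [hs, Finset.card_erase_of_mem ha]; omega)
    set B := (A.erase a).filter (χ a · = i) with hB
    have memB : ∀ {b}, b ∈ B → b ≠ a ∧ b ∈ A ∧ χ a b = i := fun hb => by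
      simpa [hB, and_assoc] using hb
    by_cases h : ∃ b ∈ B, ∃ c ∈ B, b ≠ c ∧ χ b c = i
    · obtain ⟨b, hb, c, hc, hbc, hi⟩ := h
      obtain ⟨hba, hbA, hb⟩ := memB hb
      obtain ⟨hca, hcA, hc⟩ := memB hc
      exact ⟨a, ha, b, hbA, c, hcA, hba.symm, hca.symm, hbc, hb.trans hc.symm, hb.trans hi.symm⟩
    · push Not at h
      obtain ⟨x, hx, y, hy, z, hz, hxyz⟩ := ih (S.erase i) B
        (by rw [Finset.card_erase_of_mem hi, hs]; exact hfib.le)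
        (fun b hb c hc hbc => Finset.mem_erase.2
          ⟨h b hb c hc hbc, hS b (memB hb).2.1 c (memB hc).2.1 hbc⟩)
        (by rw [Finset.card_erase_of_mem hi, hs]; rfl)
      exact ⟨x, (memB hx).2.1, y, (memB hy).2.1, z, (memB hz).2.1, hxyz⟩

section BinaryProjective

variable {W G : Type*} [DecidableEq W] [Fintype W] [AddCommGroup G] [DecidableEq G]
  {g : W → G}

/-- If `g` enumerates the nonzero elements of an elementary abelian 2-group, these are the lines of
the corresponding projective space over the field with two elements: the triples with sum zero. -/
def binaryLines (g : W → G) : Finset (Finset W) := {t | t.card = 3 ∧ ∑ x ∈ t, g x = 0}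

theorem mem_binaryLines {x y z : W} : {x, y, z} ∈ binaryLines g ↔
    x ≠ y ∧ x ≠ z ∧ y ≠ z ∧ g x + g y + g z = 0 := by
  rw [binaryLines, Finset.mem_filter, Finset.card_triple_eq_three_iff]
  simp only [Finset.mem_univ, true_and, and_assoc]
  refine and_congr_right fun hxy => and_congr_right fun hxz => and_congr_right fun hyz => ?_
  rw [Finset.sum_insert (by simp [hxy, hxz]), Finset.sum_pair hyz, add_assoc]

theorem exists_binaryLine (h2 : ∀ v : G, v + v = 0) (hg : Function.Injective g)
    (hr : Set.range g = {0}ᶜ) {x y : W} (hxy : x ≠ y) : ∃ z, {x, y, z} ∈ binaryLines g := by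
  have h0 : ∀ x, g x ≠ 0 := fun x => by
    have : g x ∈ ({0}ᶜ : Set G) := hr ▸ Set.mem_range_self x
    simpa using this
  have hne : g x + g y ≠ 0 := fun h => hxy (hg (by
    rw [← add_left_inj (g y), h, h2]))
  obtain ⟨z, hz⟩ : g x + g y ∈ Set.range g := by rw [hr]; simpa using hne
  refine ⟨z, mem_binaryLines.2 ⟨hxy, ?_, ?_, by rw [hz, h2]⟩⟩
  · rintro rfl
    exact h0 y (by simpa using hz)
  · rintro rfl
    exact h0 x (by simpa using hz)

theorem exists_isSteinerTripleSystem_binary [Nontrivial W] (h2 : ∀ v : G, v + v = 0)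
    (hg : Function.Injective g) (hr : Set.range g = {0}ᶜ) :
    ∃ T : AbstractSimplicialComplex W, T.IsSteinerTripleSystem ∧
      ∀ t, t ∈ T ∧ t.card = 3 ↔ t ∈ binaryLines g := by
  have hcov : ∀ x, ∃ t ∈ binaryLines g, x ∈ t := fun x => by
    obtain ⟨y, hy⟩ := exists_ne x
    obtain ⟨z, hz⟩ := exists_binaryLine h2 hg hr hy.symm
    exact ⟨_, hz, by simp⟩
  have hc : ∀ t ∈ binaryLines g, t.card = 2 + 1 := fun t ht => (Finset.mem_filter.1 ht).2.1
  have hmem : ∀ t, t ∈ ofFacets (binaryLines g) hcov ∧ t.card = 3 ↔ t ∈ binaryLines g :=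
    fun t => mem_ofFacets_iff_of_card_eq hc
  refine ⟨ofFacets (binaryLines g) hcov, ⟨isPure_ofFacets hc, ?_, ?_⟩, hmem⟩
  · intro x y
    rcases eq_or_ne x y with rfl | hxy
    · rw [Finset.pair_eq_singleton]
      exact singleton_mem _ x
    · obtain ⟨z, hz⟩ := exists_binaryLine h2 hg hr hxy
      exact mem_ofFacets.2 ⟨by simp, _, hz, by grind⟩
  · intro e he he2
    obtain ⟨x, y, hxy, rfl⟩ := Finset.card_eq_two.1 he2
    obtain ⟨z, hz⟩ := exists_binaryLine h2 hg hr hxy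
    refine ⟨{x, y, z}, ⟨((hmem _).2 hz).1, ((hmem _).2 hz).2, by grind⟩, ?_⟩
    rintro t ⟨ht, ht3, hst⟩
    obtain ⟨u, hu, hus⟩ := Finset.exists_mem_notMem_of_card_lt_card
      (show ({x, y} : Finset W).card < t.card by omega)
    have h3 : ({x, y, u} : Finset W).card = 3 := by
      rw [Finset.card_triple_eq_three_iff]
      grind
    obtain rfl : ({x, y, u} : Finset W) = t :=
      Finset.eq_of_subset_of_card_le (by grind) (by omega)
    have hu' := (mem_binaryLines.1 ((hmem _).1 ⟨ht, ht3⟩)).2.2.2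
    have hz' := (mem_binaryLines.1 hz).2.2.2
    rw [hg (add_left_cancel (hu'.trans hz'.symm))]

/-- The points and lines of the projective space of a vector space `G` over the field with two
elements: a colouring `c` of the points gives the colouring `c (a + b)` of the edges of the complete
graph on `G`, and a monochromatic triangle `a`, `b`, `x` of the latter gives the monochromatic line
`a + b`, `a + x`, `b + x`. -/
theorem exists_isSteinerTripleSystem_le_chromaticNumber (k : ℕ) :
    ∃ n, 3 < n ∧ ∃ T : AbstractSimplicialComplex (Fin n),
      T.IsSteinerTripleSystem ∧ (k : ℕ∞) ≤ T.chromaticNumber 2 := by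
  -- the summand `3` makes the number of points larger than three
  let d := triangleRamseyBound k + 3
  let G := Fin d → ZMod 2
  let n := Fintype.card {v : G // v ≠ 0}
  have hcard : n + 1 = 2 ^ d := by
    have : Fintype.card G = 2 ^ d := by simp [G, ZMod.card]
    have hn : n = Fintype.card G - 1 :=
      (Fintype.card_subtype_compl fun v : G => v = 0).trans (by rw [Fintype.card_subtype_eq])
    have := Fintype.card_pos (α := G)
    omega
  have hd : d < 2 ^ d := Nat.lt_two_pow_self
  have hn : 3 < n := by
    have : 2 ^ 3 ≤ 2 ^ d := Nat.pow_le_pow_right (by norm_num) (by omega)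
    omega
  have : Nontrivial (Fin n) := Fin.nontrivial_iff_two_le.2 (by omega)
  let e : Fin n ≃ {v : G // v ≠ 0} := (Fintype.equivFin _).symm
  let g : Fin n → G := fun i => e i
  have hg : Function.Injective g := Subtype.val_injective.comp e.injective
  have hr : Set.range g = {0}ᶜ := by
    ext v
    constructor
    · rintro ⟨i, rfl⟩
      exact (e i).2
    · exact fun hv => ⟨e.symm ⟨v, hv⟩, by simp [g]⟩
  have h2 : ∀ v : G, v + v = 0 := fun v => by
    ext i
    exact CharTwo.add_self_eq_zero (v i)
  obtain ⟨T, hT, hmem⟩ := exists_isSteinerTripleSystem_binary h2 hg hr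
  refine ⟨n, hn, T, hT, le_iInf₂ fun j hj => ?_⟩
  obtain ⟨c, hc⟩ := hj
  by_contra hlt
  have hjk : j ≤ k := by
    have : j < k := by simpa using hlt
    exact this.le
  have hinv : ∀ v : G, v ≠ 0 → g (Function.invFun g v) = v := fun v hv =>
    Function.invFun_eq (by
      have : v ∈ Set.range g := by rw [hr]; exact hv
      exact this)
  obtain ⟨a, -, b, -, x, -, hab, hax, hbx, h1, h3⟩ := exists_monochromatic_triangle
    (fun a b : G => c (Function.invFun g (a + b))) Finset.univ Finset.univ (by
      rw [Finset.card_univ, Finset.card_univ, Fintype.card_fin, show Fintype.card G = 2 ^ d by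
        simp [G, ZMod.card]]
      have := triangleRamseyBound_mono hjk
      omega) (fun _ _ _ _ _ => Finset.mem_univ _)
  have ne : ∀ {u v : G}, u ≠ v → u + v ≠ 0 := fun {u v} huv h => huv (by
    rw [← add_left_inj v, h, h2])
  have inv_ne : ∀ {u v : G}, u ≠ 0 → v ≠ 0 → u ≠ v →
      Function.invFun g u ≠ Function.invFun g v := fun hu hv huv h =>
    huv (by rw [← hinv _ hu, h, hinv _ hv])
  have hline : {Function.invFun g (a + b), Function.invFun g (a + x), Function.invFun g (b + x)} ∈
      binaryLines g := by
    refine mem_binaryLines.2 ⟨inv_ne (ne hab) (ne hax) (by simpa using hbx),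
      inv_ne (ne hab) (ne hbx) ?_, inv_ne (ne hax) (ne hbx) (by simpa using hab), ?_⟩
    · rw [add_comm a b]
      simpa using hax
    · rw [hinv _ (ne hab), hinv _ (ne hax), hinv _ (ne hbx),
        show a + b + (a + x) + (b + x) = (a + a) + (b + b) + (x + x) by abel, h2, h2,
        zero_add, zero_add, h2]
  obtain ⟨htT, ht3⟩ := (hmem _).2 hline
  refine hc _ htT ht3 ⟨c (Function.invFun g (a + b)), fun v hv => ?_⟩
  simp only [Finset.mem_insert, Finset.mem_singleton] at hv
  rcases hv with rfl | rfl | rfl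
  exacts [rfl, h1.symm, h3.symm]

end BinaryProjective

theorem exists_isClosedSurface_of_isSurfaceExtension {n : ℕ} {T : AbstractSimplicialComplex (Fin n)}
    {K : AbstractSimplicialComplex (Fin n ⊕ Fin (n.choose 2))} (hK : T.IsSurfaceExtension K) :
    ∃ (N : ℕ) (K' : AbstractSimplicialComplex (Fin N)), K'.IsClosedSurface ∧
      (K'.IsOrientable ↔ K.IsOrientable) ∧ T.chromaticNumber 2 ≤ K'.chromaticNumber 2 :=
  ⟨_, K.relabel finSumFinEquiv, hK.isClosedSurface.relabel _, isOrientable_relabel_iff,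
    hK.chromaticNumber_le.trans (chromaticNumber_le_relabel 2)⟩

end AbstractSimplicialComplex

theorem mainTheorem2 :
    (∀ k : ℕ,
      (∃ (N : ℕ) (K : AbstractSimplicialComplex (Fin N)),
        K.IsClosedSurface ∧ K.IsOrientable ∧ (k : ℕ∞) ≤ K.chromaticNumber 2) ∧
      (∃ (N : ℕ) (K : AbstractSimplicialComplex (Fin N)),
        K.IsClosedSurface ∧ ¬ K.IsOrientable ∧ (k : ℕ∞) ≤ K.chromaticNumber 2)) ∧
    (∀ k : ℕ, ∃ n : ℕ, 3 < n ∧ ∃ T : AbstractSimplicialComplex (Fin n),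
      T.IsSteinerTripleSystem ∧ (k : ℕ∞) ≤ T.chromaticNumber 2) ∧
    (∀ n : ℕ, 3 < n → ∀ T : AbstractSimplicialComplex (Fin n), T.IsSteinerTripleSystem →
      (∃ K, AbstractSimplicialComplex.IsSurfaceExtension T K ∧ K.IsOrientable) ∧
      (∃ K, AbstractSimplicialComplex.IsSurfaceExtension T K ∧ ¬ K.IsOrientable)) := by
  refine ⟨fun k => ?_,
    AbstractSimplicialComplex.exists_isSteinerTripleSystem_le_chromaticNumber,
    fun n hn T hT => hT.exists_isSurfaceExtension hn⟩
  obtain ⟨n, hn, T, hT, hk⟩ :=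
    AbstractSimplicialComplex.exists_isSteinerTripleSystem_le_chromaticNumber k
  obtain ⟨⟨K, hK, ho⟩, K', hK', ho'⟩ := hT.exists_isSurfaceExtension hn
  obtain ⟨N, L, hL, hLo, hLc⟩ :=
    AbstractSimplicialComplex.exists_isClosedSurface_of_isSurfaceExtension hK
  obtain ⟨N', L', hL', hLo', hLc'⟩ :=
    AbstractSimplicialComplex.exists_isClosedSurface_of_isSurfaceExtension hK'
  exact ⟨⟨N, L, hL, hLo.2 ho, hk.trans hLc⟩, ⟨N', L', hL', mt hLo'.1 ho', hk.trans hLc'⟩⟩
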